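/- For $\tau$ in the upper half-plane $\mathbb H$ write $q^s:=e^{2\pi i s\tau}$ and, for $z\in\mathbb C$, $\zeta^s:=e^{2\pi i s z}$; let $(a;q)_\infty:=\prod_{n\ge1}(1-aq^{n-1})$. Let $$\vartheta(z;\tau):=\sum_{m\in\frac12+\mathbb Z}e^{\pi i m^2\tau+2\pi i m(z+\frac12)},\qquad \eta(\tau):=q^{\frac1{24}}(q;q)_\infty,\qquad t_{a,0}(\tau):=-q^{\frac{a^2}2-\frac a2}\,\frac{(q^a;q)_\infty(q^{1-a};q)_\infty}{(q;q)_\infty^2}\quad(a\in\mathbb R)$$ be the Jacobi theta function, the Dedekind eta function and the Klein forms. Let $\mathcal R$ be the ring of functions on $\mathbb H$ generated by all $\eta(N\tau)$, $\eta(N\tau)^{-1}$ and $t_{a,0}(N\tau)$ with $N\ge1$ an integer and $a\in\mathbb Q$; its elements are the finite combinations, with integer coefficients, of products of such functions. (1) Let $k\ge1$ be an integer and, for $r\in\frac k2+\mathbb Z$, let $c_{k,r}(\tau):=\int_0^1\vartheta(x+\frac12;\tau)^k e^{-2\pi i r x}\,dx$ be the coefficient of $\zeta^r$ in $\vartheta(z+\frac12;\tau)^k$.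 Then for all $\tau\in\mathbb H$ and $z\in\mathbb C$ $$\vartheta\left(z+\tfrac12;\tau\right)^k=\sum_{r\in\frac k2+\mathbb Z}c_{k,r}(\tau)\,\zeta^r$$ with absolute convergence, and for every $r\in\frac k2+\mathbb Z$ there is $h\in\mathcal R$ such that $c_{k,r}(\tau)=q^{\frac{r^2}{2k}}\,h(\tau)$ for all $\tau\in\mathbb H$. (2) For integers $k\ge1$, $n\ge0$ let $c\phi_k(n)$ be the number of generalized Frobenius partitions of $n$ in $k$ colors, that is, of arrays $\begin{pmatrix}a_1&\cdots&a_m\\ b_1&\cdots&b_m\end{pmatrix}$ $(m\ge0)$ whose rows are strictly decreasing sequences of elements of $k$ copies of the nonnegative integers (ordered by value first, then by copy) with $n=m+\sum_{j=1}^m(a_j+b_j)$, and let $C\Phi_k(q):=\sum_{n\ge0}c\phi_k(n)q^n$. There is an algorithm which, given $k\ge1$, outputs a finite list of terms, each consisting of integers $c,e\ge0$ and of two finite lists $A,B$ of pairs $(i,j)$ of positive integers, such that for all $q\in\mathbb C$ with $|q|<1$ the series $C\Phi_k(q)$ converges absolutely and $$C\Phi_k(q)=\sum_{(c,e,A,B)}c\,q^e\,\frac{\prod_{(i,j)\in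 A}(q^i;q^j)_\infty}{\prod_{(i,j)\in B}(q^i;q^j)_\infty}.$$ -/

import Mathlib

noncomputable section

namespace FrobTheta

open Complex

/-- The infinite `q`-Pochhammer symbol `(a; q)_∞ = ∏_{n ≥ 1} (1 - a q^{n-1})`. -/
def qPoch (a q : ℂ) : ℂ := ∏' n : ℕ, (1 - a * q ^ n)

/-- The power `q ^ s` of `q = e^{2πiτ}`, that is `e^{2πisτ}`. -/
def qPow (s : ℝ) (τ : ℂ) : ℂ := cexp (2 * Real.pi * I * s * τ)

/-- The Jacobi theta function
`ϑ(z; τ) = ∑_{m ∈ 1/2 + ℤ} e^{πi m² τ + 2πi m (z + 1/2)}`, with `m = n + 1/2`. -/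
def theta (z τ : ℂ) : ℂ :=
  ∑' n : ℤ, cexp (Real.pi * I * ((n : ℂ) + 1 / 2) ^ 2 * τ +
    2 * Real.pi * I * ((n : ℂ) + 1 / 2) * (z + 1 / 2))

/-- The Klein form `t_{a,0}(τ) = -q^{(a² - a)/2} (q^a; q)_∞ (q^{1-a}; q)_∞ / (q; q)_∞²`
(the usual normalization, of weight `-1`). -/
def klein (a : ℝ) (τ : ℂ) : ℂ :=
  -qPow (a ^ 2 / 2 - a / 2) τ *
    (qPoch (qPow a τ) (qPow 1 τ) * qPoch (qPow (1 - a) τ) (qPow 1 τ)) /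
      qPoch (qPow 1 τ) (qPow 1 τ) ^ 2

/-- The ring of all polynomial expressions with integer coefficients in the functions
`η(Nτ)`, `η(Nτ)⁻¹` and `t_{a,0}(Nτ)` on the upper half-plane
(`N` a positive integer, `a` rational). Here `η` is the Dedekind eta function. -/
def etaKleinRing : Subring (UpperHalfPlane → ℂ) :=
  Subring.closure
    ({g | ∃ N : ℕ, 0 < N ∧ g = fun τ : UpperHalfPlane => ModularForm.eta ((N : ℂ) * (τ : ℂ))} ∪
     {g | ∃ N : ℕ, 0 < N ∧ g = fun τ : UpperHalfPlane => (ModularForm.eta ((N : ℂ) * (τ : ℂ)))⁻¹} ∪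
     {g | ∃ (N : ℕ) (a : ℚ), 0 < N ∧ g = fun τ : UpperHalfPlane => klein (a : ℝ) ((N : ℂ) * (τ : ℂ))})

/-- The Fourier coefficient of `ζ^{n + k/2}`, `ζ = e^{2πiz}`, in `ϑ(z + 1/2; τ)^k`. -/
def thetaPowCoeff (k : ℕ) (n : ℤ) (τ : ℂ) : ℂ :=
  ∫ x in (0 : ℝ)..1, theta ((x : ℂ) + 1 / 2) τ ^ k *
    cexp (-(2 * Real.pi * I * ((n : ℂ) + k / 2) * x))

/-- A generalized Frobenius partition of `n` in `k` colors: a two-row array whose rows are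
strictly decreasing sequences, of the same length `m`, of elements of `k` copies of the
nonnegative integers, ordered lexicographically (value first, then color), such that `n` is `m`
plus the sum of all entries. -/
structure FPartition (k n : ℕ) where
  m : ℕ
  a : Fin m → ℕ ×ₗ Fin k
  b : Fin m → ℕ ×ₗ Fin k
  a_anti : StrictAnti a
  b_anti : StrictAnti b
  sum_eq : m + ∑ j, ((ofLex (a j)).1 + (ofLex (b j)).1) = n

/-- The number `cφ_k(n)` of generalized Frobenius partitions of `n` in `k` colors. -/
def cphi (k n : ℕ) : ℕ := Nat.card (FPartition k n)

/-- A formal term `(c, e, num, den)`: it stands for `c q^e` times the product of the symbols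
`(q^i; q^j)_∞` for `(i, j)` in the list `num`, divided by the product of those for `(i, j)` in
the list `den`. -/
abbrev PochTerm := ℕ × ℕ × List (ℕ × ℕ) × List (ℕ × ℕ)

/-- All symbols `(q^i; q^j)_∞` of the term have `i, j ≥ 1`. -/
def PochTerm.Valid (t : PochTerm) : Prop :=
  ∀ p ∈ t.2.2.1 ++ t.2.2.2, 0 < p.1 ∧ 0 < p.2

/-- The value at `q` of a list of symbols `(q^i; q^j)_∞`, multiplied together. -/
def pochProd (l : List (ℕ × ℕ)) (q : ℂ) : ℂ :=
  (l.map fun p => qPoch (q ^ p.1) (q ^ p.2)).prod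

/-- The value of a term at `q`. -/
def PochTerm.eval (t : PochTerm) (q : ℂ) : ℂ :=
  (t.1 : ℂ) * q ^ t.2.1 * (pochProd t.2.2.1 q / pochProd t.2.2.2 q)

/-- The value at `q` of a finite formal sum of terms. -/
def sumEval (s : List PochTerm) (q : ℂ) : ℂ :=
  (s.map fun t => PochTerm.eval t q).sum

end FrobTheta

end

/-!
Let `B k r` be the coefficient of `ζ ^ r` in the `k`-th power of `∑ q ^ (m (m - 1) / 2) ζ ^ m`
(`thetaCoeff`). Up to an elementary factor it is the Fourier coefficient `thetaPowCoeff`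
(`thetaPowCoeff_eq`), and it is the theta series of a coset of the root lattice `A_{k-1}`. This
lattice contains, with finite index, the orthogonal sum of `A_{k-2}` and a line. Correspondingly
`B (k + 1) r` is a finite sum of products of some `B k j` and a one-dimensional theta series
`quadSum`, that is `∑ q ^ (M u² + s u)` with `M = k (k + 1) / 2` (`thetaCoeff_succ`). By Jacobi's
triple product identity `hasSum_jacobi_triple_product` each of these series is an infinite product.

The triple product identity follows by expanding the double product over pairs of finite sets. Its
functional equation under `ζ ↦ q ζ` determines the coefficients up to the constant one, and the
constant is found from the pentagonal number theorem.

For the first part, the identity `(-x; Q)_∞ = (x²; Q²)_∞ / (x; Q)_∞` turns the triple product into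
eta functions times a quotient of two Klein forms (`quadSum_eq_klein`). The denominator is
`t_{c/N,0}(Nτ)` with `0 < c < N`. It is invertible in the ring, because the product of these Klein
forms over all `c` is an eta quotient (`klein_inv_mem`). The integrality of `N · (c / N)`, which
makes this possible, holds since all exponents in the recursion are integers.

For the second part, the expansion over pairs of finite sets of colored integers shows that the
generating function of `cφ_k` is `B k 0 / (q; q)_∞ ^ k` (`hasSum_cphi`). Unfolding the recursion
for `B` produces the list `frobeniusTerms k`. The exponents of `q` in it are nonnegative after a
suitable shift of the variable in each one-dimensional series (`exists_shift`). All data in the list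
are primitive recursive functions of `k`. The argument needs `q ≠ 0`; both sides are continuous at
`q = 0`.
-/

noncomputable section

namespace FrobTheta

open Filter Topology Complex

/-! ### Absolutely convergent Fourier series -/

lemma integral_exp_int (n m : ℤ) :
    ∫ x in (0 : ℝ)..1, cexp (2 * Real.pi * I * n * x) * cexp (-(2 * Real.pi * I * m * x)) =
      if n = m then 1 else 0 := by
  have hx : ∀ x : ℝ, cexp (2 * Real.pi * I * n * x) * cexp (-(2 * Real.pi * I * m * x)) =
      cexp ((2 * Real.pi * I * (n - m : ℤ)) * x) := by
    intro x
    rw [← Complex.exp_add]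
    congr 1
    push_cast
    ring
  simp_rw [hx]
  split_ifs with h
  · simp [h]
  · have hc : 2 * Real.pi * I * ((n - m : ℤ) : ℂ) ≠ 0 :=
      mul_ne_zero Complex.two_pi_I_ne_zero (Int.cast_ne_zero.mpr (sub_ne_zero.mpr h))
    rw [integral_exp_mul_complex hc]
    have : cexp (2 * Real.pi * I * ((n - m : ℤ) : ℂ) * (1 : ℝ)) = 1 := by
      rw [Complex.exp_eq_one_iff]
      exact ⟨n - m, by push_cast; ring⟩
    rw [this]
    simp

/-- The Fourier coefficients of an absolutely convergent exponential series, in which a frequency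
may occur several times. -/
lemma integral_tsum_exp {ι : Type*} [Countable ι] {a : ι → ℂ} (ha : Summable fun i => ‖a i‖)
    (n : ι → ℤ) (m : ℤ) :
    ∫ x in (0 : ℝ)..1, (∑' i, a i * cexp (2 * Real.pi * I * n i * x)) *
        cexp (-(2 * Real.pi * I * m * x)) = ∑' i, if n i = m then a i else 0 := by
  have hn : ∀ (k : ℤ) (x : ℝ), ‖cexp (2 * Real.pi * I * k * x)‖ = 1 := by
    intro k x
    rw [show 2 * Real.pi * I * k * x = ((2 * Real.pi * k * x : ℝ) : ℂ) * I by push_cast; ring]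
    exact Complex.norm_exp_ofReal_mul_I _
  let f : ι → C(ℝ, ℂ) := fun i =>
    ⟨fun x => a i * cexp (2 * Real.pi * I * n i * x) * cexp (-(2 * Real.pi * I * m * x)),
      by fun_prop⟩
  have hf : ∀ i x, ‖f i x‖ = ‖a i‖ := by
    intro i x
    have h2 : ‖cexp (-(2 * Real.pi * I * m * x))‖ = 1 := by
      have := hn (-m) x
      rwa [show 2 * Real.pi * I * ((-m : ℤ) : ℂ) * x = -(2 * Real.pi * I * m * x) by
        push_cast; ring] at this
    simp only [f, ContinuousMap.coe_mk, norm_mul, hn, h2, mul_one]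
  have hs : Summable fun i => ‖(f i).restrict
      (⟨Set.uIcc (0 : ℝ) 1, isCompact_uIcc⟩ : TopologicalSpace.Compacts ℝ)‖ := by
    refine ha.of_nonneg_of_le (fun _ => norm_nonneg _) fun i => ?_
    rw [ContinuousMap.norm_le _ (norm_nonneg _)]
    exact fun x => (hf i x).le
  have key := (intervalIntegral.hasSum_intervalIntegral_of_summable_norm hs).tsum_eq
  simp only [f, ContinuousMap.coe_mk] at key
  simp_rw [tsum_mul_right] at key
  rw [← key]
  refine tsum_congr fun i => ?_
  simp_rw [mul_assoc (a i)]
  rw [intervalIntegral.integral_const_mul, integral_exp_int]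
  simp

/-- Comparison of coefficients on the unit circle; a frequency may occur several times on the
left. -/
lemma tsum_ite_eq_of_forall_circle {ι : Type*} [Countable ι] {a : ι → ℂ}
    (ha : Summable fun i => ‖a i‖) {b : ℤ → ℂ} (hb : Summable fun r => ‖b r‖) (n : ι → ℤ)
    (h : ∀ ζ : ℂ, ‖ζ‖ = 1 → ∑' i, a i * ζ ^ n i = ∑' r, b r * ζ ^ r) (m : ℤ) :
    ∑' i, (if n i = m then a i else 0) = b m := by
  have hz : ∀ (k : ℤ) (x : ℝ),
      cexp (2 * Real.pi * I * k * x) = cexp (2 * Real.pi * I * x) ^ k := by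
    intro k x
    rw [← Complex.exp_int_mul]
    congr 1
    ring
  rw [← integral_tsum_exp ha n m]
  have h1 : ∑' r : ℤ, (if r = m then b r else 0) = b m := by
    rw [tsum_ite_eq]
  rw [← h1, ← integral_tsum_exp hb (fun r => r) m]
  congr 1
  ext x
  simp_rw [hz]
  rw [h]
  rw [show 2 * Real.pi * I * x = ((2 * Real.pi * x : ℝ) : ℂ) * I by push_cast; ring]
  exact Complex.norm_exp_ofReal_mul_I _

lemma eq_of_forall_circle {a b : ℤ → ℂ} (ha : Summable fun i => ‖a i‖)
    (hb : Summable fun r => ‖b r‖)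
    (h : ∀ ζ : ℂ, ‖ζ‖ = 1 → ∑' r, a r * ζ ^ r = ∑' r, b r * ζ ^ r) : a = b := by
  ext m
  rw [← tsum_ite_eq_of_forall_circle ha hb (fun r => r) h m, tsum_ite_eq]

/-! ### Expansion of a double product over pairs of finite sets -/

section Pairs
variable {ι : Type*}

/-- The weight of a pair of finite sets: the two sets index the factors `1 + a i` and `1 + b i`
from which the second summand is chosen in the expansion of `∏ (1 + a i) (1 + b i)`. -/
def pairWeight (a b : ι → ℂ) (p : Finset ι × Finset ι) : ℂ := (∏ i ∈ p.1, a i) * ∏ i ∈ p.2, b i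

lemma summable_norm_pairWeight {a b : ι → ℂ} (ha : Summable fun i => ‖a i‖)
    (hb : Summable fun i => ‖b i‖) : Summable fun p => ‖pairWeight a b p‖ := by
  have h1 := summable_finsetProd_of_summable_nonneg (fun i => norm_nonneg (a i)) ha
  have h2 := summable_finsetProd_of_summable_nonneg (fun i => norm_nonneg (b i)) hb
  have := h1.mul_of_nonneg h2 (fun _ => Finset.prod_nonneg fun i _ => norm_nonneg _)
    (fun _ => Finset.prod_nonneg fun i _ => norm_nonneg _)
  refine this.congr fun p => ?_
  simp [pairWeight, norm_prod]

/-- The expansion of the double product over pairs of finite sets. -/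
lemma tsum_pairWeight {a b : ι → ℂ} (ha : Summable fun i => ‖a i‖)
    (hb : Summable fun i => ‖b i‖) :
    ∑' p, pairWeight a b p = (∏' i, (1 + a i)) * ∏' i, (1 + b i) := by
  have h1 := summable_finsetProd_of_summable_nonneg (fun i => norm_nonneg (a i)) ha
  have h2 := summable_finsetProd_of_summable_nonneg (fun i => norm_nonneg (b i)) hb
  rw [tprod_one_add (summable_finsetProd_of_summable_norm ha),
    tprod_one_add (summable_finsetProd_of_summable_norm hb)]
  symm
  apply tsum_mul_tsum_of_summable_norm
  · exact h1.congr fun s => (norm_prod _ _).symm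
  · exact h2.congr fun s => (norm_prod _ _).symm

lemma pairWeight_smul (a b : ι → ℂ) {ζ : ℂ} (hζ : ζ ≠ 0) (p : Finset ι × Finset ι) :
    pairWeight (fun i => ζ * a i) (fun i => ζ⁻¹ * b i) p =
      pairWeight a b p * ζ ^ ((p.1.card : ℤ) - p.2.card) := by
  simp only [pairWeight, Finset.prod_mul_distrib, Finset.prod_const]
  rw [zpow_sub₀ hζ, zpow_natCast, zpow_natCast, inv_pow]
  ring

lemma tsum_pairWeight_mul_zpow {a b : ι → ℂ} (ha : Summable fun i => ‖a i‖)
    (hb : Summable fun i => ‖b i‖) {ζ : ℂ} (hζ : ζ ≠ 0) :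
    ∑' p, pairWeight a b p * ζ ^ ((p.1.card : ℤ) - p.2.card) =
      (∏' i, (1 + ζ * a i)) * ∏' i, (1 + ζ⁻¹ * b i) := by
  rw [← tsum_pairWeight]
  · exact tsum_congr fun p => (pairWeight_smul a b hζ p).symm
  · simpa [norm_mul] using ha.mul_left ‖ζ‖
  · simpa [norm_mul] using hb.mul_left ‖ζ‖⁻¹

/-- The coefficient of `ζ ^ m` in `∏ (1 + ζ a i) (1 + ζ⁻¹ b i)`. -/
def pairCoeff (a b : ι → ℂ) (m : ℤ) : ℂ :=
  ∑' p : Finset ι × Finset ι, if (p.1.card : ℤ) - p.2.card = m then pairWeight a b p else 0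

lemma hasSum_pairCoeff {a b : ι → ℂ} (ha : Summable fun i => ‖a i‖)
    (hb : Summable fun i => ‖b i‖) {ζ : ℂ} (hζ : ζ ≠ 0) :
    HasSum (fun m => pairCoeff a b m * ζ ^ m)
      ((∏' i, (1 + ζ * a i)) * ∏' i, (1 + ζ⁻¹ * b i)) ∧
    Summable fun m => ‖pairCoeff a b m * ζ ^ m‖ := by
  set d : Finset ι × Finset ι → ℤ := fun p => (p.1.card : ℤ) - p.2.card with hd
  set w : Finset ι × Finset ι → ℂ := fun p => pairWeight a b p * ζ ^ d p with hw
  have hwn : Summable fun p => ‖w p‖ := by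
    have := summable_norm_pairWeight (a := fun i => ζ * a i) (b := fun i => ζ⁻¹ * b i)
      (by simpa [norm_mul] using ha.mul_left ‖ζ‖) (by simpa [norm_mul] using hb.mul_left ‖ζ‖⁻¹)
    exact this.congr fun p => by rw [pairWeight_smul a b hζ]
  -- Each pair `p` is placed over the integer `d p`; summing over the fibres gives `pairCoeff`.
  set F : ℤ × (Finset ι × Finset ι) → ℂ := fun x => if d x.2 = x.1 then w x.2 else 0 with hF
  have hinj : Function.Injective fun p : Finset ι × Finset ι => (d p, p) := fun p q h => by
    simpa using (Prod.ext_iff.mp h).2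
  have hsupp : ∀ x ∉ Set.range (fun p : Finset ι × Finset ι => (d p, p)), F x = 0 := by
    rintro ⟨m, p⟩ hx
    simp only [hF]
    rw [if_neg]
    intro h
    exact hx ⟨p, by simp [h]⟩
  have hFn : Summable fun x => ‖F x‖ := by
    rw [← hinj.summable_iff (f := fun x => ‖F x‖) (fun x hx => by rw [hsupp x hx, norm_zero])]
    simpa [Function.comp_def, hF] using hwn
  have hFs : ∑' x, F x = ∑' p, w p := by
    have : Function.support F ⊆ Set.range fun p : Finset ι × Finset ι => (d p, p) := by
      intro x hx
      by_contra h
      exact hx (hsupp x h)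
    rw [← hinj.tsum_eq this]
    simp [hF]
  have hcoef : ∀ m : ℤ, ∑' p, F (m, p) = pairCoeff a b m * ζ ^ m := by
    intro m
    rw [pairCoeff, ← tsum_mul_right]
    refine tsum_congr fun p => ?_
    simp only [hF, hw, hd]
    split_ifs with h
    · rw [h]
    · simp
  constructor
  · rw [← tsum_pairWeight_mul_zpow ha hb hζ]
    have h := hFn.of_norm.hasSum.prod_fiberwise (fun m => (hFn.of_norm.prod_factor m).hasSum)
    rw [hFs] at h
    simpa only [hcoef] using h
  · refine hFn.prod.of_nonneg_of_le (fun _ => norm_nonneg _) fun m => ?_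
    rw [← hcoef m]
    exact norm_tsum_le_tsum_norm (hFn.prod_factor m)

end Pairs

/-! ### The symbol `(x; q)_∞` -/

lemma summable_norm_mul_pow (x : ℂ) {q : ℂ} (hq : ‖q‖ < 1) : Summable fun n : ℕ => ‖x * q ^ n‖ := by
  simp_rw [norm_mul, norm_pow]
  exact (summable_geometric_of_lt_one (norm_nonneg _) hq).mul_left _

lemma qPoch_neg (x q : ℂ) : qPoch (-x) q = ∏' n : ℕ, (1 + x * q ^ n) := by
  simp [qPoch, sub_eq_add_neg]

lemma multipliable_qPoch (x : ℂ) {q : ℂ} (hq : ‖q‖ < 1) :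
    Multipliable fun n : ℕ => 1 - x * q ^ n := by
  have := multipliable_one_add_of_summable (f := fun n : ℕ => -x * q ^ n)
    (summable_norm_mul_pow (-x) hq)
  simpa [sub_eq_add_neg] using this

lemma qPoch_eq_mul (x : ℂ) {q : ℂ} (hq : ‖q‖ < 1) :
    qPoch x q = (1 - x) * qPoch (x * q) q := by
  rw [qPoch, qPoch, tprod_eq_zero_mul']
  · simp [pow_succ', mul_assoc]
  · simpa [pow_succ', mul_assoc] using multipliable_qPoch (x * q) hq

lemma qPoch_ne_zero {x q : ℂ} (hq : ‖q‖ < 1) (h : ∀ n : ℕ, x * q ^ n ≠ 1) : qPoch x q ≠ 0 := by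
  have := tprod_one_add_ne_zero_of_summable (f := fun n : ℕ => -x * q ^ n)
    (fun n hn => h n (by linear_combination -hn)) (summable_norm_mul_pow (-x) hq)
  simpa [qPoch, sub_eq_add_neg] using this

lemma qPoch_ne_zero_of_norm_lt_one {x q : ℂ} (hq : ‖q‖ < 1) (hx : ‖x‖ < 1) : qPoch x q ≠ 0 := by
  refine qPoch_ne_zero hq fun n h => ?_
  have : ‖x * q ^ n‖ < 1 := by
    rw [norm_mul, norm_pow]
    exact mul_lt_one_of_nonneg_of_lt_one_left (norm_nonneg _) hx
      (pow_le_one₀ (norm_nonneg _) hq.le)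
  rw [h] at this
  simp at this

lemma qPoch_neg_mul_qPoch (x : ℂ) {q : ℂ} (hq : ‖q‖ < 1) :
    qPoch (-x) q * qPoch x q = qPoch (x ^ 2) (q ^ 2) := by
  rw [qPoch, qPoch, qPoch, ← (multipliable_qPoch (-x) hq).tprod_mul (multipliable_qPoch x hq)]
  exact tprod_congr fun n => by ring

lemma norm_pow_lt_one {q : ℂ} (hq : ‖q‖ < 1) {n : ℕ} (hn : 0 < n) : ‖q ^ n‖ < 1 := by
  rw [norm_pow]
  exact pow_lt_one₀ (norm_nonneg _) hq hn.ne'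

/-- The factors of `(x; q)_∞` sorted by residue classes. -/
lemma prod_qPoch_pow (x : ℂ) {q : ℂ} (hq : ‖q‖ < 1) {N : ℕ} (hN : 0 < N) :
    ∏ j ∈ Finset.range N, qPoch (x * q ^ j) (q ^ N) = qPoch x q := by
  have : NeZero N := ⟨hN.ne'⟩
  have h := (multipliable_qPoch x hq).hasProd
  rw [← ((Equiv.prodComm _ _).trans (Nat.divModEquiv N).symm).hasProd_iff] at h
  have h2 := h.prod_fiberwise (g := fun j : Fin N => qPoch (x * q ^ (j : ℕ)) (q ^ N)) fun j => by
    have := (multipliable_qPoch (x * q ^ (j : ℕ)) (norm_pow_lt_one hq hN)).hasProd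
    convert! this using 2 with n
    simp [Nat.divModEquiv]
    ring
  rw [← Fin.prod_univ_eq_prod_range (fun j => qPoch (x * q ^ j) (q ^ N))]
  exact (hasProd_fintype _).unique h2

/-! ### Triangular numbers and the pentagonal number theorem -/

/-- The triangular number `m (m - 1) / 2`. -/
def tri (m : ℤ) : ℕ := (m * (m - 1) / 2).toNat

lemma two_mul_tri (m : ℤ) : 2 * (tri m : ℤ) = m * (m - 1) := by
  have h : m * (m - 1) % 2 = 0 := by
    have := Int.even_mul_pred_self m
    exact Int.even_iff.mp this
  have h0 : 0 ≤ m * (m - 1) := by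
    rcases le_or_gt m 0 with h | h <;> nlinarith
  simp only [tri]
  omega

lemma tri_add_one (m : ℤ) : (tri (m + 1) : ℤ) = tri m + m := by
  have h1 := two_mul_tri m
  have h2 := two_mul_tri (m + 1)
  linarith

section Pentagonal

lemma norm_prod_one_sub_pow_le {x : ℂ} (hx : ‖x‖ < 1) (k n : ℕ) :
    ‖∏ i ∈ Finset.range n, (1 - x ^ (k + i + 1))‖ ≤ Real.exp (1 - ‖x‖)⁻¹ := by
  calc ‖∏ i ∈ Finset.range n, (1 - x ^ (k + i + 1))‖
      ≤ ∏ i ∈ Finset.range n, (1 + ‖x‖ ^ i) := by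
        rw [norm_prod]
        refine Finset.prod_le_prod (fun _ _ => norm_nonneg _) fun i _ => ?_
        refine (norm_sub_le _ _).trans ?_
        rw [norm_one, norm_pow]
        exact add_le_add_right (pow_le_pow_of_le_one (norm_nonneg _) hx.le (by omega)) 1
    _ ≤ Real.exp (∑ i ∈ Finset.range n, ‖x‖ ^ i) :=
        Real.prod_one_add_le_exp_sum _ fun i => by positivity
    _ ≤ Real.exp (1 - ‖x‖)⁻¹ := by
        rw [Real.exp_le_exp, ← tsum_geometric_of_lt_one (norm_nonneg _) hx]
        exact (summable_geometric_of_lt_one (norm_nonneg _) hx).sum_le_tsum _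
          fun _ _ => by positivity

lemma summable_neg_one_zpow_mul_pow_pentagonal {x : ℂ} (hx : ‖x‖ < 1) :
    Summable fun m : ℤ => ((-1 : ℂ) ^ m) * x ^ pentagonal m := by
  have h := (summable_geometric_of_lt_one (norm_nonneg _) hx).comp_injective pentagonal_injective
  refine Summable.of_norm (h.congr fun m => ?_)
  simp

/-- Euler's pentagonal number theorem for a complex variable. -/
lemma tsum_pentagonal {x : ℂ} (hx : ‖x‖ < 1) :
    ∑' m : ℤ, ((-1 : ℂ) ^ m) * x ^ pentagonal m = ∏' n : ℕ, (1 - x ^ (n + 1)) := by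
  set C := Real.exp (1 - ‖x‖)⁻¹
  have hg := summable_geometric_of_lt_one (norm_nonneg _) hx
  have hterm : ∀ k n : ℕ, ‖x ^ ((k + 1) * n) *
      ∏ i ∈ Finset.range (n + 1), (1 - x ^ (k + i + 1))‖ ≤ ‖x‖ ^ n * C := by
    intro k n
    rw [norm_mul, norm_pow]
    refine mul_le_mul ?_ ?_ (norm_nonneg _) (by positivity)
    · exact pow_le_pow_of_le_one (norm_nonneg _) hx.le (by nlinarith)
    · exact norm_prod_one_sub_pow_le hx k (n + 1)
  have hsum : ∀ k, Summable (fun n ↦ x ^ ((k + 1) * n) *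
      ∏ i ∈ Finset.range (n + 1), (1 - x ^ (k + i + 1))) := fun k =>
    Summable.of_norm_bounded (hg.mul_right C) (hterm k)
  have hZ := (summable_neg_one_zpow_mul_pow_pentagonal hx).hasSum
  -- The terms at `-k` and `k + 1` are taken together, as in `Pentagonal.tprod_one_sub_pow`.
  rw [← (Equiv.neg ℤ).hasSum_iff] at hZ
  have hN := hZ.nat_add_neg_add_one
  have hNeq : ∀ k : ℕ, (((fun m : ℤ => ((-1 : ℂ) ^ m) * x ^ pentagonal m) ∘ (Equiv.neg ℤ)) k +
      ((fun m : ℤ => ((-1 : ℂ) ^ m) * x ^ pentagonal m) ∘ (Equiv.neg ℤ)) (-(k + 1))) =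
      (-1) ^ k * (x ^ pentagonal (-k) - x ^ pentagonal (k + 1)) := by
    intro k
    simp only [Function.comp_apply, Equiv.neg_apply, neg_neg, zpow_neg, zpow_natCast]
    rw [show ((k : ℤ) + 1) = ((k + 1 : ℕ) : ℤ) by push_cast; ring, zpow_natCast]
    rcases neg_one_pow_eq_or ℂ k with h | h <;> simp [h, pow_succ] <;> ring
  simp_rw [hNeq] at hN
  rw [Pentagonal.tprod_one_sub_pow (tendsto_pow_atTop_nhds_zero_of_norm_lt_one hx) hsum
    ?_ hN.summable ?_]
  · rw [hN.tsum_eq]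
  · intro k
    have := multipliable_qPoch (x ^ (k + 1)) hx
    refine this.congr fun n => ?_
    ring
  · have hlim : Tendsto (fun k : ℕ => ‖x‖ ^ k * (∑' n : ℕ, ‖x‖ ^ n * C)) atTop (𝓝 0) := by
      simpa using (tendsto_pow_atTop_nhds_zero_of_lt_one (norm_nonneg _) hx).mul_const
        (∑' n : ℕ, ‖x‖ ^ n * C)
    refine squeeze_zero_norm (fun k => ?_) hlim
    rw [norm_mul, norm_mul, norm_pow, norm_neg, norm_one, one_pow, one_mul, norm_pow]
    refine mul_le_mul ?_ ?_ (norm_nonneg _) (by positivity)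
    · refine pow_le_pow_of_le_one (norm_nonneg _) hx.le ?_
      rw [Nat.le_div_iff_mul_le (by norm_num)]
      nlinarith
    · exact tsum_of_norm_bounded (hg.mul_right C).hasSum (hterm k)

end Pentagonal

/-! ### The triple product identity -/

section TripleProduct

lemma tprod_mul_tprod_eq_qPoch (q : ℂ) (ζ : ℂ) :
    (∏' n : ℕ, (1 + ζ * q ^ n)) * ∏' n : ℕ, (1 + ζ⁻¹ * q ^ (n + 1)) =
      qPoch (-ζ) q * qPoch (-(q / ζ)) q := by
  rw [qPoch_neg, qPoch_neg]
  congr 1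
  exact tprod_congr fun n => by ring

/-- The functional equation `P (ζ) = ζ P (q ζ)` of the double product `P`,
compared coefficientwise. -/
lemma pairCoeff_add_one {q : ℂ} (hq0 : q ≠ 0) (hq : ‖q‖ < 1) (m : ℤ) :
    pairCoeff (fun n : ℕ => q ^ n) (fun n : ℕ => q ^ (n + 1)) (m + 1) =
      q ^ m * pairCoeff (fun n : ℕ => q ^ n) (fun n : ℕ => q ^ (n + 1)) m := by
  set c := pairCoeff (fun n : ℕ => q ^ n) (fun n : ℕ => q ^ (n + 1)) with hc
  have ha : Summable fun n : ℕ => ‖q ^ n‖ := by simpa using summable_norm_mul_pow 1 hq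
  have hb : Summable fun n : ℕ => ‖q ^ (n + 1)‖ := by
    simpa [pow_succ'] using summable_norm_mul_pow q hq
  have hsum : ∀ ζ : ℂ, ζ ≠ 0 → _ := fun ζ hζ => hasSum_pairCoeff ha hb hζ
  simp_rw [tprod_mul_tprod_eq_qPoch, ← hc] at hsum
  have hn1 : Summable fun m => ‖c (m + 1)‖ := by
    have := (hsum 1 one_ne_zero).2
    simp only [one_zpow, mul_one] at this
    exact ((Equiv.addRight (1 : ℤ)).summable_iff (f := fun m => ‖c m‖)).mpr this
  have hn2 : Summable fun m => ‖q ^ m * c m‖ := by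
    simpa [mul_comm] using (hsum q hq0).2
  refine congrFun (eq_of_forall_circle hn1 hn2 fun ζ hζ => ?_) m
  have hζ0 : ζ ≠ 0 := by
    rintro rfl
    simp at hζ
  have h1 := (hsum ζ hζ0).1
  rw [← (Equiv.addRight (1 : ℤ)).hasSum_iff] at h1
  have h2 := (hsum (q * ζ) (mul_ne_zero hq0 hζ0)).1
  -- Replacing `ζ` by `q ζ` removes the factor `1 + ζ` and creates the factor `1 + ζ⁻¹`.
  have hfun : qPoch (-ζ) q * qPoch (-(q / ζ)) q =
      ζ * (qPoch (-(q * ζ)) q * qPoch (-(q / (q * ζ))) q) := by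
    rw [qPoch_eq_mul (-ζ) hq, qPoch_eq_mul (-(q / (q * ζ))) hq,
      show -(q / (q * ζ)) * q = -(q / ζ) by field_simp, show -ζ * q = -(q * ζ) by ring]
    field_simp
    ring
  rw [hfun] at h1
  have h3 := (h1.mul_left ζ⁻¹).tsum_eq
  rw [inv_mul_cancel_left₀ hζ0, ← h2.tsum_eq] at h3
  have e1 : ∀ r : ℤ, ζ⁻¹ * (((fun m => c m * ζ ^ m) ∘ (Equiv.addRight (1 : ℤ))) r) =
      c (r + 1) * ζ ^ r := by
    intro r
    simp only [Function.comp_apply, Equiv.coe_addRight, zpow_add_one₀ hζ0]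
    field_simp
  simp_rw [e1] at h3
  rw [h3]
  refine tsum_congr fun r => ?_
  rw [mul_zpow]
  ring

lemma pairCoeff_eq_pow_tri {q : ℂ} (hq0 : q ≠ 0) (hq : ‖q‖ < 1) (m : ℤ) :
    pairCoeff (fun n : ℕ => q ^ n) (fun n : ℕ => q ^ (n + 1)) m =
      q ^ tri m * pairCoeff (fun n : ℕ => q ^ n) (fun n : ℕ => q ^ (n + 1)) 0 := by
  have hstep : ∀ m : ℤ, q ^ tri (m + 1) = q ^ m * q ^ tri m := by
    intro m
    rw [← zpow_natCast, ← zpow_natCast, ← zpow_add₀ hq0, tri_add_one, add_comm]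
  induction m using Int.induction_on with
  | zero => simp [tri]
  | succ i ih => rw [pairCoeff_add_one hq0 hq, ih, hstep]; ring
  | pred i ih =>
    have h1 := pairCoeff_add_one hq0 hq (-(i : ℤ) - 1)
    have h2 := hstep (-(i : ℤ) - 1)
    rw [sub_add_cancel] at h1 h2
    rw [h1, h2, mul_assoc] at ih
    exact mul_left_cancel₀ (zpow_ne_zero _ hq0) ih

/-- The triple product identity up to the value of the constant term of the product. -/
lemma hasSum_pow_tri_mul_pairCoeff {q : ℂ} (hq0 : q ≠ 0) (hq : ‖q‖ < 1) {ζ : ℂ} (hζ : ζ ≠ 0) :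
    HasSum (fun m : ℤ => pairCoeff (fun n : ℕ => q ^ n) (fun n : ℕ => q ^ (n + 1)) 0 *
      (q ^ tri m * ζ ^ m)) (qPoch (-ζ) q * qPoch (-(q / ζ)) q) ∧
    Summable fun m : ℤ => ‖pairCoeff (fun n : ℕ => q ^ n) (fun n : ℕ => q ^ (n + 1)) 0 *
      (q ^ tri m * ζ ^ m)‖ := by
  have ha : Summable fun n : ℕ => ‖q ^ n‖ := by simpa using summable_norm_mul_pow 1 hq
  have hb : Summable fun n : ℕ => ‖q ^ (n + 1)‖ := by
    simpa [pow_succ'] using summable_norm_mul_pow q hq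
  have h := hasSum_pairCoeff ha hb hζ
  rw [tprod_mul_tprod_eq_qPoch] at h
  have e : ∀ m : ℤ, pairCoeff (fun n : ℕ => q ^ n) (fun n : ℕ => q ^ (n + 1)) m * ζ ^ m =
      pairCoeff (fun n : ℕ => q ^ n) (fun n : ℕ => q ^ (n + 1)) 0 * (q ^ tri m * ζ ^ m) := by
    intro m
    rw [pairCoeff_eq_pow_tri hq0 hq]
    ring
  simpa only [e] using h

/-- The constant in the triple product identity. After replacing `q` by `q³` and `ζ` by `-q`, the
series is the one in the pentagonal number theorem. -/
lemma pairCoeff_zero_mul_qPoch {q : ℂ} (hq0 : q ≠ 0) (hq : ‖q‖ < 1) :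
    pairCoeff (fun n : ℕ => q ^ n) (fun n : ℕ => q ^ (n + 1)) 0 * qPoch q q = 1 := by
  obtain ⟨x, rfl⟩ := IsAlgClosed.exists_pow_nat_eq q (n := 3) (by norm_num)
  have hx0 : x ≠ 0 := by
    rintro rfl
    simp at hq0
  have hx : ‖x‖ < 1 := by
    by_contra! h
    rw [norm_pow] at hq
    exact absurd (one_le_pow₀ h (n := 3)) (not_le.mpr hq)
  have h := (hasSum_pow_tri_mul_pairCoeff hq0 hq (neg_ne_zero.mpr hx0)).1.tsum_eq
  rw [tsum_mul_left] at h
  have e : ∀ m : ℤ, (x ^ 3) ^ tri m * (-x) ^ m = (-1 : ℂ) ^ m * x ^ pentagonal m := by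
    intro m
    rw [← pow_mul, neg_eq_neg_one_mul x, mul_zpow, ← zpow_natCast x, ← zpow_natCast x,
      mul_left_comm, ← zpow_add₀ hx0]
    congr 2
    have h1 := two_mul_tri m
    have h2 := two_mul_natCast_pentagonal m
    push_cast
    linarith
  simp_rw [e] at h
  rw [tsum_pentagonal hx] at h
  have h2 : ∏' n : ℕ, (1 - x ^ (n + 1)) = qPoch x x := by
    simp [qPoch, pow_succ']
  have h3 := prod_qPoch_pow x hx (N := 3) (by norm_num)
  simp only [Finset.prod_range_succ, Finset.prod_range_zero, one_mul, pow_zero, mul_one,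
    pow_one] at h3
  rw [h2, ← h3, neg_neg, show -(x ^ 3 / -x) = x * x by field_simp,
    show x * x ^ 2 = x ^ 3 by ring] at h
  have hne : qPoch x (x ^ 3) * qPoch (x * x) (x ^ 3) ≠ 0 := by
    refine mul_ne_zero (qPoch_ne_zero_of_norm_lt_one hq hx)
      (qPoch_ne_zero_of_norm_lt_one hq ?_)
    rw [← pow_two]
    exact norm_pow_lt_one hx (by norm_num)
  apply mul_left_cancel₀ hne
  linear_combination h

/-- **Jacobi's triple product identity.** -/
theorem hasSum_jacobi_triple_product {q : ℂ} (hq0 : q ≠ 0) (hq : ‖q‖ < 1) {ζ : ℂ} (hζ : ζ ≠ 0) :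
    HasSum (fun m : ℤ => q ^ tri m * ζ ^ m)
      (qPoch q q * (qPoch (-ζ) q * qPoch (-(q / ζ)) q)) := by
  have h := (hasSum_pow_tri_mul_pairCoeff hq0 hq hζ).1.mul_left (qPoch q q)
  have e := pairCoeff_zero_mul_qPoch hq0 hq
  have e2 : ∀ m : ℤ, qPoch q q * (pairCoeff (fun n : ℕ => q ^ n) (fun n : ℕ => q ^ (n + 1)) 0 *
      (q ^ tri m * ζ ^ m)) = q ^ tri m * ζ ^ m := by
    intro m
    linear_combination (q ^ tri m * ζ ^ m) * e
  simpa only [e2] using h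

lemma summable_norm_pow_tri_mul_zpow {q : ℂ} (hq0 : q ≠ 0) (hq : ‖q‖ < 1) {ζ : ℂ} (hζ : ζ ≠ 0) :
    Summable fun m : ℤ => ‖q ^ tri m * ζ ^ m‖ := by
  have h := (hasSum_pow_tri_mul_pairCoeff hq0 hq hζ).2
  simp_rw [norm_mul (pairCoeff _ _ _)] at h
  refine (summable_mul_left_iff ?_).mp h
  exact norm_ne_zero_iff.mpr (left_ne_zero_of_mul_eq_one (pairCoeff_zero_mul_qPoch hq0 hq))

end TripleProduct

/-! ### The coefficients of powers of the theta series -/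

/-- The product of two absolutely convergent series over `ℤ`, summed along the diagonals. -/
lemma hasSum_convolution {f g : ℤ → ℂ} (hf : Summable fun r => ‖f r‖)
    (hg : Summable fun r => ‖g r‖) :
    HasSum (fun r => ∑' t, f t * g (r - t)) ((∑' r, f r) * ∑' r, g r) ∧
      (Summable fun r => ‖∑' t, f t * g (r - t)‖) ∧ ∀ r, Summable fun t => f t * g (r - t) := by
  let e : ℤ × ℤ ≃ ℤ × ℤ :=
    { toFun := fun p => (p.2, p.1 - p.2)
      invFun := fun p => (p.1 + p.2, p.1)
      left_inv := fun p => by simp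
      right_inv := fun p => by simp }
  have hn : Summable fun p : ℤ × ℤ => ‖f p.2 * g (p.1 - p.2)‖ :=
    e.summable_iff.mpr (hf.mul_norm hg)
  have hs : HasSum (fun p : ℤ × ℤ => f p.2 * g (p.1 - p.2)) ((∑' r, f r) * ∑' r, g r) := by
    have h := (hf.mul_norm hg).of_norm.hasSum
    rw [← tsum_mul_tsum_of_summable_norm hf hg] at h
    exact e.hasSum_iff.mpr h
  refine ⟨hs.prod_fiberwise fun r => (hn.of_norm.prod_factor r).hasSum, ?_,
    fun r => hn.of_norm.prod_factor r⟩
  exact hn.prod.of_nonneg_of_le (fun _ => norm_nonneg _) fun r =>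
    norm_tsum_le_tsum_norm (hn.prod_factor r)

/-- The coefficient of `ζ ^ r` in the `k`-th power of `∑ q ^ (m (m - 1) / 2) ζ ^ m`. -/
def thetaCoeff (q : ℂ) : ℕ → ℤ → ℂ
  | 0, r => if r = 0 then 1 else 0
  | k + 1, r => ∑' t : ℤ, q ^ tri t * thetaCoeff q k (r - t)

lemma thetaCoeff_laurent {q : ℂ} (hq0 : q ≠ 0) (hq : ‖q‖ < 1) {ζ : ℂ} (hζ : ζ ≠ 0) (k : ℕ) :
    HasSum (fun r : ℤ => thetaCoeff q k r * ζ ^ r) ((∑' m : ℤ, q ^ tri m * ζ ^ m) ^ k) ∧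
      Summable fun r : ℤ => ‖thetaCoeff q k r * ζ ^ r‖ := by
  induction k with
  | zero =>
    have e : ∀ r : ℤ, thetaCoeff q 0 r * ζ ^ r = if r = 0 then 1 else 0 := by
      intro r
      simp only [thetaCoeff]
      split_ifs with h <;> simp [h]
    simp_rw [e, pow_zero]
    refine ⟨hasSum_ite_eq 0 1, ?_⟩
    exact summable_of_ne_finset_zero (s := {0}) fun r hr => by
      rw [if_neg (by simpa using hr), norm_zero]
  | succ k ih =>
    have h := hasSum_convolution (summable_norm_pow_tri_mul_zpow hq0 hq hζ) ih.2
    have e : ∀ r : ℤ, ∑' t : ℤ, q ^ tri t * ζ ^ t * (thetaCoeff q k (r - t) * ζ ^ (r - t)) =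
        thetaCoeff q (k + 1) r * ζ ^ r := by
      intro r
      rw [thetaCoeff, ← tsum_mul_right]
      refine tsum_congr fun t => ?_
      rw [zpow_sub₀ hζ]
      field_simp
    simp_rw [e] at h
    rw [ih.1.tsum_eq, ← pow_succ'] at h
    exact ⟨h.1, h.2.1⟩

lemma summable_norm_thetaCoeff {q : ℂ} (hq0 : q ≠ 0) (hq : ‖q‖ < 1) (k : ℕ) :
    Summable fun r : ℤ => ‖thetaCoeff q k r‖ := by
  simpa using (thetaCoeff_laurent hq0 hq one_ne_zero k).2

lemma summable_thetaCoeff_step {q : ℂ} (hq0 : q ≠ 0) (hq : ‖q‖ < 1) (k : ℕ) (r : ℤ) :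
    Summable fun t : ℤ => q ^ tri t * thetaCoeff q k (r - t) := by
  have h : Summable fun m : ℤ => ‖q ^ tri m‖ := by
    simpa using summable_norm_pow_tri_mul_zpow hq0 hq one_ne_zero
  exact (hasSum_convolution h (summable_norm_thetaCoeff hq0 hq k)).2.2 r

lemma thetaCoeff_one (q : ℂ) (r : ℤ) : thetaCoeff q 1 r = q ^ tri r := by
  rw [thetaCoeff, tsum_eq_single r]
  · simp [thetaCoeff]
  · intro t ht
    rw [thetaCoeff, if_neg (by omega), mul_zero]

/-- Translating the summation variables by a constant vector relates the coefficients whose indices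
are congruent modulo `k`. -/
lemma thetaCoeff_add_mul {q : ℂ} (hq0 : q ≠ 0) (k : ℕ) (r u : ℤ) :
    thetaCoeff q k (r + k * u) = q ^ ((k : ℤ) * tri u + u * r) * thetaCoeff q k r := by
  induction k generalizing r with
  | zero =>
    simp only [thetaCoeff]
    by_cases h : r = 0 <;> simp [h]
  | succ k ih =>
    rw [thetaCoeff, thetaCoeff, ← tsum_mul_left, ← (Equiv.addRight u).tsum_eq]
    refine tsum_congr fun t => ?_
    rw [Equiv.coe_addRight, show r + ((k + 1 : ℕ) : ℤ) * u - (t + u) = r - t + k * u by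
      push_cast; ring, ih, ← zpow_natCast, ← zpow_natCast, ← mul_assoc, ← mul_assoc,
      ← zpow_add₀ hq0, ← zpow_add₀ hq0]
    congr 2
    have h1 := two_mul_tri t
    have h2 := two_mul_tri u
    have h3 := two_mul_tri (t + u)
    push_cast
    linarith

/-- The one-dimensional theta series `∑ q ^ (M u² + s u)`, `u ∈ ℤ`. -/
def quadSum (q : ℂ) (M : ℕ) (s : ℤ) : ℂ := ∑' u : ℤ, q ^ ((M : ℤ) * u ^ 2 + s * u)

lemma quadSum_eq_qPoch {q : ℂ} (hq0 : q ≠ 0) (hq : ‖q‖ < 1) {M : ℕ} (hM : 0 < M) (s : ℤ) :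
    quadSum q M s = qPoch (q ^ (2 * M)) (q ^ (2 * M)) *
      (qPoch (-q ^ ((M : ℤ) + s)) (q ^ (2 * M)) * qPoch (-q ^ ((M : ℤ) - s)) (q ^ (2 * M))) := by
  have h := hasSum_jacobi_triple_product (pow_ne_zero (2 * M) hq0)
    (norm_pow_lt_one hq (n := 2 * M) (by omega)) (zpow_ne_zero ((M : ℤ) + s) hq0)
  have e : q ^ (2 * M) / q ^ ((M : ℤ) + s) = q ^ ((M : ℤ) - s) := by
    rw [← zpow_natCast, ← zpow_sub₀ hq0]
    congr 1
    push_cast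
    ring
  rw [e] at h
  rw [← h.tsum_eq, quadSum]
  refine tsum_congr fun u => ?_
  rw [← pow_mul, ← zpow_natCast, ← zpow_mul, ← zpow_add₀ hq0]
  congr 1
  have := two_mul_tri u
  push_cast
  linear_combination (-(M : ℤ)) * this

lemma quadSum_shift {q : ℂ} (hq0 : q ≠ 0) (M : ℕ) (s v : ℤ) :
    quadSum q M s = q ^ ((M : ℤ) * v ^ 2 + s * v) * quadSum q M (s + 2 * M * v) := by
  rw [quadSum, quadSum, ← tsum_mul_left, ← (Equiv.addRight v).tsum_eq]
  refine tsum_congr fun u => ?_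
  rw [Equiv.coe_addRight, ← zpow_add₀ hq0]
  congr 1
  ring

/-- The lattice behind the `(k + 1)`-st power splits, up to finite index, into the lattice behind
the `k`-th power and an orthogonal line, on which the theta series is one-dimensional. -/
lemma thetaCoeff_succ {q : ℂ} (hq0 : q ≠ 0) (hq : ‖q‖ < 1) {k : ℕ} (hk : 0 < k) (r : ℤ) :
    thetaCoeff q (k + 1) r = ∑ j ∈ Finset.range k, thetaCoeff q k j *
      (q ^ tri (r - j) * quadSum q (k * (k + 1) / 2) ((k + 1) * j - k * r)) := by
  have : NeZero k := ⟨hk.ne'⟩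
  have hM : (2 : ℤ) * ((k * (k + 1) / 2 : ℕ) : ℤ) = k * (k + 1) := by
    have := Nat.div_mul_cancel (even_iff_two_dvd.mp (Nat.even_mul_succ_self k))
    zify at this ⊢
    linarith
  -- The summation variable `t` is written as `r - (j + k u)` with `0 ≤ j < k`.
  let e : Fin k × ℤ ≃ ℤ :=
    ((Equiv.prodComm _ _).trans (Int.divModEquiv k).symm).trans (Equiv.subLeft r)
  have he : ∀ (j : Fin k) (u : ℤ), e (j, u) = r - (j + k * u) := fun j u => by
    simp [e, Int.divModEquiv]
    ring
  have hs : Summable fun c => q ^ tri (e c) * thetaCoeff q k (r - e c) :=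
    (summable_thetaCoeff_step hq0 hq k r).comp_injective e.injective
  rw [thetaCoeff, ← e.tsum_eq, hs.tsum_prod, tsum_fintype,
    ← Fin.sum_univ_eq_sum_range (fun j => thetaCoeff q k j *
      (q ^ tri (r - j) * quadSum q (k * (k + 1) / 2) ((k + 1) * j - k * r)))]
  refine Finset.sum_congr rfl fun j _ => ?_
  rw [quadSum, ← tsum_mul_left, ← tsum_mul_left]
  refine tsum_congr fun u => ?_
  rw [he, sub_sub_cancel, thetaCoeff_add_mul hq0, ← zpow_natCast, ← zpow_natCast,
    ← mul_assoc, ← zpow_add₀ hq0, ← zpow_add₀ hq0, mul_comm]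
  congr 2
  have h1 := two_mul_tri (r - (j + k * u))
  have h2 := two_mul_tri u
  have h3 := two_mul_tri (r - j)
  refine mul_left_cancel₀ (two_ne_zero (α := ℤ)) ?_
  linear_combination h1 + (k : ℤ) * h2 - h3 - u ^ 2 * hM

/-! ### The Fourier coefficients of powers of the Jacobi theta function -/

section Theta

lemma qPow_add (s t : ℝ) (τ : ℂ) : qPow (s + t) τ = qPow s τ * qPow t τ := by
  rw [qPow, qPow, qPow, ← Complex.exp_add]
  congr 1
  push_cast
  ring

lemma qPow_ne_zero (s : ℝ) (τ : ℂ) : qPow s τ ≠ 0 := Complex.exp_ne_zero _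

lemma qPow_pow (s : ℝ) (τ : ℂ) (n : ℕ) : qPow s τ ^ n = qPow (n * s) τ := by
  rw [qPow, qPow, ← Complex.exp_nat_mul]
  congr 1
  push_cast
  ring

lemma qPow_zpow (s : ℝ) (τ : ℂ) (n : ℤ) : qPow s τ ^ n = qPow (n * s) τ := by
  rw [qPow, qPow, ← Complex.exp_int_mul]
  congr 1
  push_cast
  ring

lemma qPow_natCast_mul (s : ℝ) (τ : ℂ) (n : ℕ) : qPow s (n * τ) = qPow (n * s) τ := by
  rw [qPow, qPow]
  congr 1
  push_cast
  ring

lemma norm_qPow_lt_one {s : ℝ} (hs : 0 < s) (τ : UpperHalfPlane) : ‖qPow s (τ : ℂ)‖ < 1 := by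
  rw [qPow, Complex.norm_exp, Real.exp_lt_one_iff]
  have h := τ.im_pos
  have : (2 * Real.pi * I * s * (τ : ℂ)).re = -(2 * Real.pi * s * τ.im) := by
    rw [show 2 * Real.pi * I * s * (τ : ℂ) = ((2 * Real.pi * s : ℝ) : ℂ) * (I * (τ : ℂ)) by
      push_cast; ring, Complex.re_ofReal_mul, Complex.I_mul_re]
    simp
  rw [this]
  have := Real.pi_pos
  simp only [Left.neg_neg_iff]
  positivity

/-- The theta function in the variable `m = n + 1`, with the fractional powers of `q` and `ζ` taken
out of the series. -/
lemma theta_add_half (z τ : ℂ) :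
    theta (z + 1 / 2) τ = -qPow (1 / 8) τ * cexp (-(Real.pi * I * z)) *
      ∑' m : ℤ, qPow 1 τ ^ tri m * cexp (2 * Real.pi * I * z) ^ m := by
  rw [theta, ← tsum_mul_left, ← (Equiv.addRight (1 : ℤ)).tsum_eq (fun m : ℤ =>
    -qPow (1 / 8) τ * cexp (-(Real.pi * I * z)) *
      (qPow 1 τ ^ tri m * cexp (2 * Real.pi * I * z) ^ m))]
  refine tsum_congr fun n => ?_
  have h1 : ((tri (n + 1) : ℕ) : ℂ) = (n + 1) * n / 2 := by
    have := two_mul_tri (n + 1)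
    have h2 : (2 : ℂ) * (tri (n + 1) : ℕ) = (n + 1) * (n + 1 - 1) := by exact_mod_cast this
    linear_combination h2 / 2
  have h2 : cexp (Real.pi * I * ((n : ℂ) + 1 / 2) ^ 2 * τ +
      2 * Real.pi * I * ((n : ℂ) + 1 / 2) * (z + 1 / 2 + 1 / 2)) =
      cexp (2 * Real.pi * I * (1 / 8 : ℝ) * τ) * cexp (-(Real.pi * I * z)) *
        (cexp (tri (n + 1) * (2 * Real.pi * I * (1 : ℝ) * τ)) *
          cexp ((n + 1 : ℤ) * (2 * Real.pi * I * z))) *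
          (cexp (n * (2 * Real.pi * I)) * cexp (Real.pi * I)) := by
    rw [← Complex.exp_add, ← Complex.exp_add, ← Complex.exp_add, ← Complex.exp_add,
      ← Complex.exp_add, h1]
    congr 1
    push_cast
    ring
  rw [h2, Complex.exp_int_mul_two_pi_mul_I, Complex.exp_pi_mul_I, Equiv.coe_addRight,
    Complex.exp_nat_mul, Complex.exp_int_mul, qPow, qPow]
  ring

lemma theta_add_half_pow (k : ℕ) (n : ℤ) (z τ : ℂ) :
    theta (z + 1 / 2) τ ^ k * cexp (-(2 * Real.pi * I * ((n : ℂ) + k / 2) * z)) =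
      (-qPow (1 / 8) τ) ^ k * ((∑' m : ℤ, qPow 1 τ ^ tri m * cexp (2 * Real.pi * I * z) ^ m) ^ k *
        cexp (-(2 * Real.pi * I * (n + k : ℤ) * z))) := by
  rw [theta_add_half, mul_pow, mul_pow, ← Complex.exp_nat_mul]
  have : cexp (-(2 * Real.pi * I * (n + k : ℤ) * z)) = cexp (k * -(Real.pi * I * z)) *
      cexp (-(2 * Real.pi * I * ((n : ℂ) + k / 2) * z)) := by
    rw [← Complex.exp_add]
    congr 1
    push_cast
    ring
  rw [this]
  ring

lemma thetaPowCoeff_eq (k : ℕ) (n : ℤ) (τ : UpperHalfPlane) :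
    thetaPowCoeff k n τ =
      (-qPow (1 / 8) (τ : ℂ)) ^ k * thetaCoeff (qPow 1 (τ : ℂ)) k (n + k) := by
  have hq := norm_qPow_lt_one one_pos τ
  have hq0 := qPow_ne_zero 1 (τ : ℂ)
  rw [thetaPowCoeff]
  simp_rw [theta_add_half_pow]
  rw [intervalIntegral.integral_const_mul]
  congr 1
  have h := integral_tsum_exp (summable_norm_thetaCoeff hq0 hq k) (fun r => r) (n + k)
  rw [tsum_ite_eq] at h
  rw [← h]
  congr 1
  ext x
  congr 1
  rw [← (thetaCoeff_laurent hq0 hq (Complex.exp_ne_zero (2 * Real.pi * I * x)) k).1.tsum_eq]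
  refine tsum_congr fun r => ?_
  rw [← Complex.exp_int_mul]
  congr 2
  ring

lemma hasSum_thetaPowCoeff (k : ℕ) (τ : UpperHalfPlane) (z : ℂ) :
    HasSum (fun n : ℤ => thetaPowCoeff k n (τ : ℂ) *
        cexp (2 * Real.pi * I * ((n : ℂ) + k / 2) * z)) (theta (z + 1 / 2) (τ : ℂ) ^ k) := by
  have hq := norm_qPow_lt_one one_pos τ
  have hq0 := qPow_ne_zero 1 (τ : ℂ)
  have h := (thetaCoeff_laurent hq0 hq (Complex.exp_ne_zero (2 * Real.pi * I * z)) k).1.mul_left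
    ((-qPow (1 / 8) (τ : ℂ)) ^ k * cexp (k * -(Real.pi * I * z)))
  rw [← (Equiv.addRight (k : ℤ)).hasSum_iff] at h
  convert! h using 1
  · ext n
    simp only [Function.comp_apply, Equiv.coe_addRight]
    rw [thetaPowCoeff_eq, ← Complex.exp_int_mul]
    have : cexp (2 * Real.pi * I * ((n : ℂ) + k / 2) * z) = cexp (k * -(Real.pi * I * z)) *
        cexp ((n + k : ℤ) * (2 * Real.pi * I * z)) := by
      rw [← Complex.exp_add]
      congr 1
      push_cast
      ring
    rw [this]
    ring
  · rw [theta_add_half, mul_pow, mul_pow, ← Complex.exp_nat_mul]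

end Theta

/-! ### One-dimensional theta series in terms of Klein forms -/

lemma eta_natCast_mul_mem {N : ℕ} (hN : 0 < N) :
    (fun τ : UpperHalfPlane => ModularForm.eta ((N : ℂ) * (τ : ℂ))) ∈ etaKleinRing :=
  Subring.subset_closure (.inl (.inl ⟨N, hN, rfl⟩))

lemma eta_natCast_mul_inv_mem {N : ℕ} (hN : 0 < N) :
    (fun τ : UpperHalfPlane => (ModularForm.eta ((N : ℂ) * (τ : ℂ)))⁻¹) ∈ etaKleinRing :=
  Subring.subset_closure (.inl (.inr ⟨N, hN, rfl⟩))

lemma klein_natCast_mul_mem {N : ℕ} (hN : 0 < N) (c D : ℕ) :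
    (fun τ : UpperHalfPlane => klein ((c : ℝ) / D) ((N : ℂ) * (τ : ℂ))) ∈ etaKleinRing :=
  Subring.subset_closure (.inr ⟨N, c / D, hN, by simp⟩)

lemma eta_natCast_mul (N : ℕ) (τ : ℂ) :
    ModularForm.eta ((N : ℂ) * τ) =
      qPow (N / 24) τ * qPoch (qPow 1 τ ^ N) (qPow 1 τ ^ N) := by
  have h : cexp (2 * Real.pi * I * (N * τ)) = qPow 1 τ ^ N := by
    rw [qPow, ← Complex.exp_nat_mul]
    congr 1
    push_cast
    ring
  rw [ModularForm.eta, qPoch]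
  simp_rw [ModularForm.eta_q_eq_pow, h, pow_succ']
  congr 1
  rw [Function.Periodic.qParam, qPow]
  congr 1
  push_cast
  ring

lemma klein_div_natCast {N c : ℕ} (hN : 0 < N) (hc : c ≤ N) (τ : ℂ) :
    klein ((c : ℝ) / N) ((N : ℂ) * τ) = -qPow (((c : ℝ) ^ 2 / N - c) / 2) τ *
      (qPoch (qPow 1 τ ^ c) (qPow 1 τ ^ N) * qPoch (qPow 1 τ ^ (N - c)) (qPow 1 τ ^ N)) /
        qPoch (qPow 1 τ ^ N) (qPow 1 τ ^ N) ^ 2 := by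
  have hN' : (N : ℝ) ≠ 0 := by positivity
  rw [klein]
  simp only [qPow_natCast_mul, qPow_pow]
  have e1 : (N : ℝ) * (((c : ℝ) / N) ^ 2 / 2 - (c : ℝ) / N / 2) = ((c : ℝ) ^ 2 / N - c) / 2 := by
    field_simp
  have e2 : (N : ℝ) * ((c : ℝ) / N) = c * 1 := by field_simp
  have e3 : (N : ℝ) * (1 - (c : ℝ) / N) = ((N - c : ℕ) : ℝ) * 1 := by
    rw [Nat.cast_sub hc]
    field_simp
  rw [e1, e2, e3]

lemma prod_qPow {ι : Type*} (s : Finset ι) (f : ι → ℝ) (τ : ℂ) :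
    ∏ i ∈ s, qPow (f i) τ = qPow (∑ i ∈ s, f i) τ := by
  classical
  induction s using Finset.induction_on with
  | empty => simp [qPow]
  | insert i s hi ih => rw [Finset.prod_insert hi, Finset.sum_insert hi, qPow_add, ih]

section
variable (τ : UpperHalfPlane)

lemma qPoch_qPow_ne_zero {m n : ℕ} (hm : 0 < m) (hn : 0 < n) :
    qPoch (qPow 1 (τ : ℂ) ^ m) (qPow 1 (τ : ℂ) ^ n) ≠ 0 :=
  qPoch_ne_zero_of_norm_lt_one (norm_pow_lt_one (norm_qPow_lt_one one_pos τ) hn)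
    (norm_pow_lt_one (norm_qPow_lt_one one_pos τ) hm)

lemma eta_natCast_mul_ne_zero {N : ℕ} (hN : 0 < N) :
    ModularForm.eta ((N : ℂ) * (τ : ℂ)) ≠ 0 := by
  rw [eta_natCast_mul]
  exact mul_ne_zero (qPow_ne_zero _ _) (qPoch_qPow_ne_zero τ hN hN)

/-- The product of all Klein forms with characteristics `j / N` is an eta quotient. -/
lemma prod_klein (n : ℕ) :
    ∏ i ∈ Finset.range n,
        klein (((i + 1 : ℕ) : ℝ) / (n + 1 : ℕ)) (((n + 1 : ℕ) : ℂ) * (τ : ℂ)) =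
      (-1) ^ n * ModularForm.eta (((1 : ℕ) : ℂ) * (τ : ℂ)) ^ 2 /
        ModularForm.eta (((n + 1 : ℕ) : ℂ) * (τ : ℂ)) ^ (2 * (n + 1)) := by
  set q := qPow 1 (τ : ℂ) with hqdef
  have hq : ‖q‖ < 1 := norm_qPow_lt_one one_pos τ
  set E := qPoch (q ^ (n + 1)) (q ^ (n + 1)) with hE
  have hE0 : E ≠ 0 := qPoch_qPow_ne_zero τ (Nat.succ_pos n) (Nat.succ_pos n)
  -- `X i` and its mirror image `X (n - 1 - i)` are the two products in the `i`-th Klein form.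
  set X : ℕ → ℂ := fun i => qPoch (q ^ (i + 1)) (q ^ (n + 1)) with hX
  have hP : (∏ i ∈ Finset.range n, X i) * E = qPoch q q := by
    rw [← prod_qPoch_pow q hq (Nat.succ_pos n), Finset.prod_range_succ]
    simp [hX, hE, pow_succ']
  have hterm : ∀ i ∈ Finset.range n,
      klein (((i + 1 : ℕ) : ℝ) / (n + 1 : ℕ)) (((n + 1 : ℕ) : ℂ) * (τ : ℂ)) =
      (-1) * qPow ((((i + 1 : ℕ) : ℝ) ^ 2 / (n + 1 : ℕ) - (i + 1 : ℕ)) / 2) (τ : ℂ) *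
        (X i * X (n - 1 - i)) * (E ^ 2)⁻¹ := by
    intro i hi
    have hi' := Finset.mem_range.mp hi
    rw [klein_div_natCast (Nat.succ_pos n) (by omega)]
    have : n + 1 - (i + 1) = n - 1 - i + 1 := by omega
    rw [this]
    simp only [hX, hE, hqdef]
    ring
  rw [Finset.prod_congr rfl hterm]
  simp only [Finset.prod_mul_distrib, Finset.prod_const, Finset.card_range]
  rw [Finset.prod_range_reflect X n, prod_qPow, eta_natCast_mul, eta_natCast_mul, pow_one,
    ← hqdef, ← hE, ← hP]
  have hexp : ∀ (m : ℕ) (K : ℝ), ∑ i ∈ Finset.range m, (((i + 1 : ℕ) : ℝ) ^ 2 / K - (i + 1 : ℕ)) / 2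
      = m * (m + 1) * (2 * m + 1) / (12 * K) - m * (m + 1) / 4 := by
    intro m K
    induction m with
    | zero => simp
    | succ m ih =>
      rw [Finset.sum_range_succ, ih]
      push_cast
      ring
  have hq2 : qPow (∑ i ∈ Finset.range n,
      (((i + 1 : ℕ) : ℝ) ^ 2 / (n + 1 : ℕ) - (i + 1 : ℕ)) / 2) (τ : ℂ) *
        qPow ((n + 1 : ℕ) / 24) (τ : ℂ) ^ (2 * (n + 1)) = qPow ((1 : ℕ) / 24) (τ : ℂ) ^ 2 := by
    rw [qPow_pow, qPow_pow, ← qPow_add, hexp]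
    congr 1
    have : ((n : ℝ) + 1) ≠ 0 := by positivity
    push_cast
    field_simp
    ring
  rw [mul_pow, mul_pow, ← hq2]
  have h1 := qPow_ne_zero ((n + 1 : ℕ) / 24) (τ : ℂ)
  generalize qPow (∑ i ∈ Finset.range n,
    (((i + 1 : ℕ) : ℝ) ^ 2 / (n + 1 : ℕ) - (i + 1 : ℕ)) / 2) (τ : ℂ) = S
  generalize qPow ((n + 1 : ℕ) / 24) (τ : ℂ) = V at h1 ⊢
  rw [inv_pow, ← pow_mul]
  field_simp
  ring

end

/-- Klein forms with nonintegral characteristic `c / N`, at `N τ`, are units of the ring: the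
product over all characteristics is an eta quotient. -/
lemma klein_inv_mem {N c : ℕ} (hc0 : 0 < c) (hc : c < N) :
    (fun τ : UpperHalfPlane => (klein ((c : ℝ) / N) ((N : ℂ) * (τ : ℂ)))⁻¹) ∈ etaKleinRing := by
  obtain ⟨n, rfl⟩ : ∃ n, N = n + 1 := ⟨N - 1, by omega⟩
  obtain ⟨d, rfl⟩ : ∃ d, c = d + 1 := ⟨c - 1, by omega⟩
  have hd : d ∈ Finset.range n := Finset.mem_range.mpr (by omega)
  have key : (fun τ : UpperHalfPlane =>
      (klein (((d + 1 : ℕ) : ℝ) / (n + 1 : ℕ)) (((n + 1 : ℕ) : ℂ) * (τ : ℂ)))⁻¹) =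
      (-1) ^ n * (∏ i ∈ (Finset.range n).erase d, fun τ : UpperHalfPlane =>
        klein (((i + 1 : ℕ) : ℝ) / (n + 1 : ℕ)) (((n + 1 : ℕ) : ℂ) * (τ : ℂ))) *
      (fun τ : UpperHalfPlane =>
        ModularForm.eta (((n + 1 : ℕ) : ℂ) * (τ : ℂ))) ^ (2 * (n + 1)) *
      (fun τ : UpperHalfPlane => (ModularForm.eta (((1 : ℕ) : ℂ) * (τ : ℂ)))⁻¹) ^ 2 := by
    ext τ
    simp only [Pi.mul_apply, Pi.pow_apply, Finset.prod_apply, Pi.neg_apply, Pi.one_apply]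
    have h := prod_klein τ n
    rw [← Finset.mul_prod_erase _ _ hd] at h
    have h2 := eta_natCast_mul_ne_zero τ one_pos
    have h3 := eta_natCast_mul_ne_zero τ (by omega : 0 < n + 1)
    have h4 : ((-1 : ℂ) ^ n) * (-1) ^ n = 1 := by rw [← mul_pow]; simp
    rw [eq_div_iff (pow_ne_zero _ h3)] at h
    refine inv_eq_of_mul_eq_one_right ?_
    generalize ModularForm.eta (((1 : ℕ) : ℂ) * (τ : ℂ)) = a at h h2 ⊢
    generalize ModularForm.eta (((n + 1 : ℕ) : ℂ) * (τ : ℂ)) = b at h h3 ⊢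
    have h5 : a ^ 2 * a⁻¹ ^ 2 = 1 := by rw [← mul_pow, mul_inv_cancel₀ h2, one_pow]
    linear_combination (-1 : ℂ) ^ n * a⁻¹ ^ 2 * h + a ^ 2 * a⁻¹ ^ 2 * h4 + h5
  rw [key]
  refine mul_mem (mul_mem (mul_mem (pow_mem (neg_mem (one_mem _)) _) (prod_mem fun i _ =>
    klein_natCast_mul_mem (Nat.succ_pos n) _ _)) (pow_mem (eta_natCast_mul_mem (Nat.succ_pos n)) _))
    (pow_mem (eta_natCast_mul_inv_mem one_pos) _)

lemma qPow_mul_quadSum_shift (M : ℕ) (hM : 0 < M) (s v : ℤ) (τ : ℂ) :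
    qPow ((s : ℝ) ^ 2 / (4 * M)) τ * quadSum (qPow 1 τ) M s =
      qPow (((s + 2 * M * v : ℤ) : ℝ) ^ 2 / (4 * M)) τ * quadSum (qPow 1 τ) M (s + 2 * M * v) := by
  have hM' : (M : ℝ) ≠ 0 := by positivity
  rw [quadSum_shift (qPow_ne_zero 1 τ) M s v, ← mul_assoc, qPow_zpow, ← qPow_add]
  congr 2
  push_cast
  field_simp
  ring

/-- Combines the triple product with `(-x; Q)_∞ = (x²; Q²)_∞ / (x; Q)_∞`, which turns the products
with plus signs into a quotient of Klein forms at `2 N τ` and at `N τ`, where `N = 2 M`. -/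
lemma quadSum_eq_klein {M c : ℕ} (hc0 : 0 < c) (hc : c < 2 * M) (τ : UpperHalfPlane) :
    qPow ((((c : ℤ) - M : ℤ) : ℝ) ^ 2 / (4 * M)) (τ : ℂ) *
        quadSum (qPow 1 (τ : ℂ)) M ((c : ℤ) - M) =
      klein (((2 * c : ℕ) : ℝ) / (2 * (2 * M) : ℕ)) (((2 * (2 * M) : ℕ) : ℂ) * (τ : ℂ)) *
        (klein ((c : ℝ) / (2 * M : ℕ)) (((2 * M : ℕ) : ℂ) * (τ : ℂ)))⁻¹ *
        (ModularForm.eta (((2 * (2 * M) : ℕ) : ℂ) * (τ : ℂ)) ^ 2 *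
          (ModularForm.eta (((2 * M : ℕ) : ℂ) * (τ : ℂ)))⁻¹) := by
  have hM : 0 < M := by omega
  have hM' : (M : ℝ) ≠ 0 := by positivity
  rw [klein_div_natCast (by omega) (by omega), klein_div_natCast (by omega) (by omega),
    eta_natCast_mul, eta_natCast_mul, quadSum_eq_qPoch (qPow_ne_zero 1 _)
      (norm_qPow_lt_one one_pos τ) hM]
  set q := qPow 1 (τ : ℂ) with hqdef
  have hq : ‖q‖ < 1 := norm_qPow_lt_one one_pos τ
  have hQ : ‖q ^ (2 * M)‖ < 1 := norm_pow_lt_one hq (by omega)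
  rw [show (M : ℤ) + (c - M) = (c : ℕ) by ring,
    show (M : ℤ) - (c - M) = ((2 * M - c : ℕ) : ℤ) by rw [Nat.cast_sub hc.le]; push_cast; ring,
    zpow_natCast, zpow_natCast]
  have h1 := qPoch_neg_mul_qPoch (q ^ c) hQ
  have h2 := qPoch_neg_mul_qPoch (q ^ (2 * M - c)) hQ
  rw [← pow_mul, ← pow_mul] at h1 h2
  rw [show 2 * (2 * M) - 2 * c = (2 * M - c) * 2 by omega, show 2 * c = c * 2 by omega,
    show 2 * (2 * M) = 2 * M * 2 by omega, ← h1, ← h2]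
  have n1 : qPoch (q ^ c) (q ^ (2 * M)) ≠ 0 := qPoch_qPow_ne_zero τ hc0 (by omega)
  have n2 : qPoch (q ^ (2 * M - c)) (q ^ (2 * M)) ≠ 0 :=
    qPoch_qPow_ne_zero τ (by omega) (by omega)
  have n3 : qPoch (q ^ (2 * M)) (q ^ (2 * M)) ≠ 0 := qPoch_qPow_ne_zero τ (by omega) (by omega)
  have n4 : qPoch (q ^ (2 * M * 2)) (q ^ (2 * M * 2)) ≠ 0 :=
    qPoch_qPow_ne_zero τ (by omega) (by omega)
  have e : qPow ((((c : ℤ) - M : ℤ) : ℝ) ^ 2 / (4 * M)) (τ : ℂ) *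
      qPow (((c : ℝ) ^ 2 / (2 * M : ℕ) - c) / 2) (τ : ℂ) * qPow ((2 * M : ℕ) / 24) (τ : ℂ) =
      qPow ((((c * 2 : ℕ) : ℝ) ^ 2 / (2 * M * 2 : ℕ) - (c * 2 : ℕ)) / 2) (τ : ℂ) *
        qPow ((2 * M * 2 : ℕ) / 24) (τ : ℂ) ^ 2 := by
    rw [qPow_pow, ← qPow_add, ← qPow_add, ← qPow_add]
    congr 1
    push_cast
    field_simp
    ring
  have p1 := qPow_ne_zero (((c : ℝ) ^ 2 / (2 * M : ℕ) - c) / 2) (τ : ℂ)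
  have p2 := qPow_ne_zero ((2 * M : ℕ) / 24) (τ : ℂ)
  generalize qPow (((c : ℝ) ^ 2 / (2 * M : ℕ) - c) / 2) (τ : ℂ) = w₁ at e p1 ⊢
  generalize qPow ((2 * M : ℕ) / 24) (τ : ℂ) = w₂ at e p2 ⊢
  generalize qPow ((((c * 2 : ℕ) : ℝ) ^ 2 / (2 * M * 2 : ℕ) - (c * 2 : ℕ)) / 2) (τ : ℂ) = w₃
    at e ⊢
  field_simp
  linear_combination qPoch (-q ^ c) (q ^ (2 * M)) * qPoch (-q ^ (2 * M - c)) (q ^ (2 * M)) * e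

/-- The case excluded in `quadSum_eq_klein`: here the Klein forms in the quotient vanish. -/
lemma quadSum_eq_eta {M : ℕ} (hM : 0 < M) (τ : UpperHalfPlane) :
    qPow (((-M : ℤ) : ℝ) ^ 2 / (4 * M)) (τ : ℂ) * quadSum (qPow 1 (τ : ℂ)) M (-M) =
      2 * (ModularForm.eta (((2 * (2 * M) : ℕ) : ℂ) * (τ : ℂ)) ^ 2 *
          (ModularForm.eta (((2 * M : ℕ) : ℂ) * (τ : ℂ)))⁻¹) := by
  have hM' : (M : ℝ) ≠ 0 := by positivity
  rw [eta_natCast_mul, eta_natCast_mul, quadSum_eq_qPoch (qPow_ne_zero 1 _)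
      (norm_qPow_lt_one one_pos τ) hM]
  set q := qPow 1 (τ : ℂ) with hqdef
  have hq : ‖q‖ < 1 := norm_qPow_lt_one one_pos τ
  have hQ : ‖q ^ (2 * M)‖ < 1 := norm_pow_lt_one hq (by omega)
  rw [show (M : ℤ) + -M = 0 by ring, show (M : ℤ) - -M = ((2 * M : ℕ) : ℤ) by push_cast; ring,
    zpow_natCast, zpow_zero, qPoch_eq_mul (-1) hQ, neg_one_mul]
  have h1 := qPoch_neg_mul_qPoch (q ^ (2 * M)) hQ
  rw [← pow_mul] at h1
  rw [show 2 * (2 * M) = 2 * M * 2 by omega, ← h1]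
  have n3 : qPoch (q ^ (2 * M)) (q ^ (2 * M)) ≠ 0 := qPoch_qPow_ne_zero τ (by omega) (by omega)
  have e : qPow (((-M : ℤ) : ℝ) ^ 2 / (4 * M)) (τ : ℂ) * qPow ((2 * M : ℕ) / 24) (τ : ℂ) =
        qPow ((2 * M * 2 : ℕ) / 24) (τ : ℂ) ^ 2 := by
    rw [qPow_pow, ← qPow_add]
    congr 1
    push_cast
    field_simp
    ring
  have p2 := qPow_ne_zero ((2 * M : ℕ) / 24) (τ : ℂ)
  field_simp
  linear_combination 2 * qPoch (-q ^ (2 * M)) (q ^ (2 * M)) ^ 2 * e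

lemma qPow_mul_quadSum_mem {M : ℕ} (hM : 0 < M) (s : ℤ) :
    (fun τ : UpperHalfPlane => qPow ((s : ℝ) ^ 2 / (4 * M)) (τ : ℂ) *
      quadSum (qPow 1 (τ : ℂ)) M s) ∈ etaKleinRing := by
  have hpos : (0 : ℤ) < 2 * M := by positivity
  obtain ⟨c, hc⟩ := Int.eq_ofNat_of_zero_le (Int.emod_nonneg (M + s) hpos.ne')
  have hlt : (c : ℤ) < 2 * M := hc ▸ Int.emod_lt_of_pos (M + s) hpos
  have hs : s + 2 * M * (-((M + s) / (2 * M))) = (c : ℤ) - M := by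
    have := Int.emod_add_mul_ediv (M + s) (2 * M)
    rw [hc] at this
    linarith
  simp_rw [fun τ : UpperHalfPlane => qPow_mul_quadSum_shift M hM s (-((M + s) / (2 * M))) (τ : ℂ),
    hs]
  rcases Nat.eq_zero_or_pos c with rfl | hc0
  · simp_rw [Nat.cast_zero, zero_sub, quadSum_eq_eta hM]
    exact mul_mem (ofNat_mem _ 2) (mul_mem (pow_mem (eta_natCast_mul_mem (by omega)) 2)
      (eta_natCast_mul_inv_mem (by omega)))
  · have hlt' : c < 2 * M := by exact_mod_cast hlt
    simp_rw [quadSum_eq_klein hc0 hlt']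
    exact mul_mem (mul_mem (klein_natCast_mul_mem (by omega) _ _) (klein_inv_mem hc0 hlt'))
      (mul_mem (pow_mem (eta_natCast_mul_mem (by omega)) 2) (eta_natCast_mul_inv_mem (by omega)))

/-! ### The normalized Fourier coefficients lie in the ring -/

/-- The normalized coefficients of `(∑ q ^ (m (m - 1) / 2) ζ ^ m) ^ k`, which depend on the index
modulo `k` only, are in the ring. -/
lemma qPow_mul_thetaCoeff_mem {k : ℕ} (hk : 0 < k) (r : ℤ) :
    (fun τ : UpperHalfPlane => qPow ((r : ℝ) / 2 - (r : ℝ) ^ 2 / (2 * k)) (τ : ℂ) *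
      thetaCoeff (qPow 1 (τ : ℂ)) k r) ∈ etaKleinRing := by
  induction k, hk using Nat.le_induction generalizing r with
  | base =>
    convert one_mem etaKleinRing using 1
    ext τ
    rw [thetaCoeff_one, qPow_pow, ← qPow_add, Pi.one_apply, qPow]
    have h : (2 : ℝ) * (tri r : ℕ) = r * (r - 1) := by exact_mod_cast two_mul_tri r
    rw [show (r : ℝ) / 2 - (r : ℝ) ^ 2 / (2 * (1 : ℕ)) + (tri r : ℕ) * 1 = 0 by
      push_cast
      linear_combination h / 2]
    simp
  | succ k hk ih =>
    have hk' : (0 : ℝ) < k := by exact_mod_cast hk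
    set M := k * (k + 1) / 2 with hMdef
    have hM2 : M * 2 = k * (k + 1) :=
      Nat.div_mul_cancel (even_iff_two_dvd.mp (Nat.even_mul_succ_self k))
    have hM : 0 < M := by
      have : 0 < k * (k + 1) := by positivity
      omega
    have hMr : (M : ℝ) = k * (k + 1) / 2 := by
      have : (M : ℝ) * 2 = k * (k + 1) := by exact_mod_cast hM2
      linarith
    have key : (fun τ : UpperHalfPlane =>
        qPow ((r : ℝ) / 2 - (r : ℝ) ^ 2 / (2 * (k + 1 : ℕ))) (τ : ℂ) *
          thetaCoeff (qPow 1 (τ : ℂ)) (k + 1) r) = ∑ j ∈ Finset.range k,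
        (fun τ : UpperHalfPlane => qPow (((j : ℤ) : ℝ) / 2 - ((j : ℤ) : ℝ) ^ 2 / (2 * k)) (τ : ℂ) *
          thetaCoeff (qPow 1 (τ : ℂ)) k (j : ℤ)) *
        (fun τ : UpperHalfPlane =>
          qPow ((((k + 1) * j - k * r : ℤ) : ℝ) ^ 2 / (4 * M)) (τ : ℂ) *
            quadSum (qPow 1 (τ : ℂ)) M ((k + 1) * j - k * r)) := by
      ext τ
      rw [Finset.sum_apply, thetaCoeff_succ (qPow_ne_zero 1 _) (norm_qPow_lt_one one_pos τ) hk,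
        Finset.mul_sum]
      refine Finset.sum_congr rfl fun j _ => ?_
      have h : (2 : ℝ) * (tri (r - j) : ℕ) = (r - j) * (r - j - 1) := by
        exact_mod_cast two_mul_tri (r - j)
      -- Orthogonality: `r² / (k + 1)` and `((k + 1) j - k r)² / (k (k + 1))` add up to
      -- `j² / k + (r - j)²`.
      have e : qPow ((r : ℝ) / 2 - (r : ℝ) ^ 2 / (2 * (k + 1 : ℕ))) (τ : ℂ) *
          qPow 1 (τ : ℂ) ^ tri (r - j) =
          qPow (((j : ℤ) : ℝ) / 2 - ((j : ℤ) : ℝ) ^ 2 / (2 * k)) (τ : ℂ) *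
            qPow ((((k + 1) * j - k * r : ℤ) : ℝ) ^ 2 / (4 * M)) (τ : ℂ) := by
        rw [qPow_pow, ← qPow_add, ← qPow_add]
        congr 1
        rw [hMr, show ((tri (r - j) : ℕ) : ℝ) = (r - j) * (r - j - 1) / 2 by linarith]
        push_cast
        field_simp
        ring
      simp only [Pi.mul_apply]
      linear_combination thetaCoeff (qPow 1 (τ : ℂ)) k j *
        quadSum (qPow 1 (τ : ℂ)) M ((k + 1) * j - k * r) * e
    rw [key]
    exact sum_mem fun j _ => mul_mem (ih j) (qPow_mul_quadSum_mem hM _)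

lemma exists_mem_thetaPowCoeff_eq {k : ℕ} (hk : 0 < k) (n : ℤ) :
    ∃ h ∈ etaKleinRing, ∀ τ : UpperHalfPlane, thetaPowCoeff k n (τ : ℂ) =
      qPow (((n : ℝ) + k / 2) ^ 2 / (2 * k)) (τ : ℂ) * h τ := by
  refine ⟨(-1) ^ k * _, mul_mem (pow_mem (neg_mem (one_mem _)) k)
    (qPow_mul_thetaCoeff_mem hk (n + k)), fun τ => ?_⟩
  have hk' : (k : ℝ) ≠ 0 := by positivity
  have e : qPow (((n : ℝ) + k / 2) ^ 2 / (2 * k)) (τ : ℂ) *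
      qPow (((n + k : ℤ) : ℝ) / 2 - ((n + k : ℤ) : ℝ) ^ 2 / (2 * k)) (τ : ℂ) =
      qPow (1 / 8) (τ : ℂ) ^ k := by
    rw [qPow_pow, ← qPow_add]
    congr 1
    push_cast
    field_simp
    ring
  rw [thetaPowCoeff_eq, neg_pow, ← e]
  simp only [Pi.mul_apply, Pi.pow_apply, Pi.neg_apply, Pi.one_apply]
  ring

/-! ### The generating function of generalized Frobenius partitions -/

lemma summable_norm_colored (k : ℕ) {f : ℕ → ℂ} (hf : Summable fun n => ‖f n‖) :
    Summable fun i : ℕ ×ₗ Fin k => ‖f (ofLex i).1‖ := by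
  rw [← ((Equiv.prodComm (Fin k) ℕ).trans toLex).summable_iff]
  refine (summable_prod_of_nonneg fun _ => norm_nonneg _).mpr ⟨fun j => ?_, ?_⟩
  · simpa using hf
  · exact (hasSum_fintype _).summable

/-- Each factor occurs once for every color. -/
lemma tprod_colored (k : ℕ) {f : ℕ → ℂ} (hf : Summable fun n => ‖f n‖) :
    ∏' i : ℕ ×ₗ Fin k, (1 + f (ofLex i).1) = (∏' n, (1 + f n)) ^ k := by
  have h := (multipliable_one_add_of_summable (summable_norm_colored k hf)).hasProd
  rw [← ((Equiv.prodComm (Fin k) ℕ).trans toLex).hasProd_iff] at h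
  have h2 := h.prod_fiberwise (g := fun _ : Fin k => ∏' n, (1 + f n)) fun j => by
    simpa using (multipliable_one_add_of_summable hf).hasProd
  have h3 := (hasProd_fintype (fun _ : Fin k => ∏' n, (1 + f n))).unique h2
  rw [← h3]
  simp

/-- The pairs of finite sets of the same cardinality; they are the rows of the generalized
Frobenius partitions. -/
abbrev BalancedPair (k : ℕ) : Type :=
  {p : Finset (ℕ ×ₗ Fin k) × Finset (ℕ ×ₗ Fin k) // p.1.card = p.2.card}

/-- The number partitioned by the two rows. -/
def BalancedPair.size {k : ℕ} (p : BalancedPair k) : ℕ :=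
  ∑ i ∈ p.1.1, (ofLex i).1 + ∑ i ∈ p.1.2, ((ofLex i).1 + 1)

lemma eq_of_image_eq {α : Type*} [LinearOrder α] {m : ℕ} {f g : Fin m → α} (hf : StrictAnti f)
    (hg : StrictAnti g) (h : Finset.univ.image f = Finset.univ.image g) : f = g := by
  have hcard : (Finset.univ.image f).card = m := by
    rw [Finset.card_image_of_injective _ hf.injective, Finset.card_fin]
  have h1 := Finset.orderEmbOfFin_unique hcard (f := f ∘ Fin.rev) (fun x => by simp)
    (hf.comp Fin.rev_strictAnti)
  have h2 := Finset.orderEmbOfFin_unique hcard (f := g ∘ Fin.rev) (fun x => by rw [h]; simp)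
    (hg.comp Fin.rev_strictAnti)
  ext x
  have := congrFun (h1.trans h2.symm) (Fin.rev x)
  simpa using this

lemma exists_strictAnti_image_eq {α : Type*} [LinearOrder α] {m : ℕ} (s : Finset α)
    (hs : s.card = m) : ∃ f : Fin m → α, StrictAnti f ∧ Finset.univ.image f = s := by
  refine ⟨s.orderEmbOfFin hs ∘ Fin.rev,
    (s.orderEmbOfFin hs).strictMono.comp_strictAnti Fin.rev_strictAnti, ?_⟩
  apply Finset.coe_injective
  rw [Finset.coe_image, Finset.coe_univ, Set.image_univ,
    Fin.rev_surjective.range_comp, Finset.range_orderEmbOfFin]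

/-- The rows of a generalized Frobenius partition, as sets. -/
def FPartition.rows {k n : ℕ} (P : FPartition k n) : {p : BalancedPair k // p.size = n} :=
  ⟨⟨(Finset.univ.image P.a, Finset.univ.image P.b), by
    rw [Finset.card_image_of_injective _ P.a_anti.injective,
      Finset.card_image_of_injective _ P.b_anti.injective]⟩, by
    rw [BalancedPair.size, Finset.sum_image P.a_anti.injective.injOn,
      Finset.sum_image P.b_anti.injective.injOn]
    refine Eq.trans ?_ P.sum_eq
    rw [Finset.sum_add_distrib, Finset.sum_add_distrib]
    simp only [Finset.sum_const, Finset.card_univ, Fintype.card_fin, smul_eq_mul, mul_one]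
    ring⟩

lemma FPartition.rows_bijective (k n : ℕ) :
    Function.Bijective (FPartition.rows (k := k) (n := n)) := by
  constructor
  · rintro ⟨m, a, b, ha, hb, hs⟩ ⟨m', a', b', ha', hb', hs'⟩ h
    have h1 : Finset.univ.image a = Finset.univ.image a' :=
      congrArg (fun x => x.1.1.1) h
    have h2 : Finset.univ.image b = Finset.univ.image b' :=
      congrArg (fun x => x.1.1.2) h
    obtain rfl : m = m' := by
      have := congrArg Finset.card h1
      rwa [Finset.card_image_of_injective _ ha.injective,
        Finset.card_image_of_injective _ ha'.injective, Finset.card_fin, Finset.card_fin] at this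
    obtain rfl := eq_of_image_eq ha ha' h1
    obtain rfl := eq_of_image_eq hb hb' h2
    rfl
  · rintro ⟨⟨⟨A, B⟩, hAB⟩, hn⟩
    obtain ⟨m, hm⟩ : ∃ m, A.card = m := ⟨_, rfl⟩
    obtain ⟨a, ha, rfl⟩ := exists_strictAnti_image_eq A hm
    obtain ⟨b, hb, rfl⟩ := exists_strictAnti_image_eq B (hAB.symm.trans hm)
    refine ⟨⟨_, a, b, ha, hb, ?_⟩, rfl⟩
    rw [← hn, BalancedPair.size, Finset.sum_image ha.injective.injOn,
      Finset.sum_image hb.injective.injOn, Finset.sum_add_distrib, Finset.sum_add_distrib]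
    simp only [Finset.sum_const, Finset.card_univ, Fintype.card_fin, smul_eq_mul, mul_one]
    ring

lemma pairWeight_eq_pow_size {k : ℕ} (q : ℂ) (p : BalancedPair k) :
    pairWeight (fun i : ℕ ×ₗ Fin k => q ^ (ofLex i).1)
      (fun i : ℕ ×ₗ Fin k => q ^ ((ofLex i).1 + 1)) p.1 = q ^ p.size := by
  rw [pairWeight, Finset.prod_pow_eq_pow_sum, Finset.prod_pow_eq_pow_sum, ← pow_add,
    BalancedPair.size]

/-- The pairs of finite sets of colored integers are counted by the `k`-th power of the double
product in the triple product identity. -/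
lemma pairCoeff_colored {q : ℂ} (hq0 : q ≠ 0) (hq : ‖q‖ < 1) (k : ℕ) (r : ℤ) :
    pairCoeff (fun i : ℕ ×ₗ Fin k => q ^ (ofLex i).1)
      (fun i : ℕ ×ₗ Fin k => q ^ ((ofLex i).1 + 1)) r = thetaCoeff q k r / qPoch q q ^ k := by
  have hE : qPoch q q ≠ 0 := qPoch_ne_zero_of_norm_lt_one hq hq
  have ha0 : Summable fun n : ℕ => ‖q ^ n‖ := by simpa using summable_norm_mul_pow 1 hq
  have hb0 : Summable fun n : ℕ => ‖q ^ (n + 1)‖ := by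
    simpa [pow_succ'] using summable_norm_mul_pow q hq
  have ha := summable_norm_colored k ha0
  have hb := summable_norm_colored k hb0
  have : Countable (ℕ ×ₗ Fin k) := inferInstanceAs (Countable (ℕ × Fin k))
  refine tsum_ite_eq_of_forall_circle (summable_norm_pairWeight ha hb)
    (b := fun r => thetaCoeff q k r / qPoch q q ^ k) ?_
    (fun p => (p.1.card : ℤ) - p.2.card) (fun ζ hζ => ?_) r
  · simp_rw [norm_div]
    exact (summable_norm_thetaCoeff hq0 hq k).div_const _
  · have hζ0 : ζ ≠ 0 := by
      rintro rfl
      simp at hζ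
    rw [tsum_pairWeight_mul_zpow ha hb hζ0,
      tprod_colored k (f := fun n => ζ * q ^ n) (by simpa [norm_mul] using ha0.mul_left ‖ζ‖),
      tprod_colored k (f := fun n => ζ⁻¹ * q ^ (n + 1))
        (by simpa [norm_mul] using hb0.mul_left ‖ζ‖⁻¹), ← mul_pow, tprod_mul_tprod_eq_qPoch]
    have h := (thetaCoeff_laurent hq0 hq hζ0 k).1.div_const (qPoch q q ^ k)
    rw [(hasSum_jacobi_triple_product hq0 hq hζ0).tsum_eq, mul_pow,
      mul_div_cancel_left₀ _ (pow_ne_zero _ hE)] at h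
    rw [← h.tsum_eq]
    exact tsum_congr fun r => by ring

lemma hasSum_pow_size {q : ℂ} (hq0 : q ≠ 0) (hq : ‖q‖ < 1) (k : ℕ) :
    HasSum (fun p : BalancedPair k => q ^ p.size) (thetaCoeff q k 0 / qPoch q q ^ k) := by
  have ha0 : Summable fun n : ℕ => ‖q ^ n‖ := by simpa using summable_norm_mul_pow 1 hq
  have hb0 : Summable fun n : ℕ => ‖q ^ (n + 1)‖ := by
    simpa [pow_succ'] using summable_norm_mul_pow q hq
  have hw := summable_norm_pairWeight (summable_norm_colored k ha0) (summable_norm_colored k hb0)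
  have h2 : HasSum _ _ := (hw.of_norm.comp_injective
    (Subtype.val_injective (p := fun p : Finset (ℕ ×ₗ Fin k) × Finset (ℕ ×ₗ Fin k) =>
      p.1.card = p.2.card))).hasSum
  have e : ∀ p : BalancedPair k, (pairWeight (fun i : ℕ ×ₗ Fin k => q ^ (ofLex i).1)
      (fun i : ℕ ×ₗ Fin k => q ^ ((ofLex i).1 + 1)) ∘ Subtype.val) p = q ^ p.size :=
    pairWeight_eq_pow_size q
  have e2 : ∑' p : BalancedPair k, (pairWeight (fun i : ℕ ×ₗ Fin k => q ^ (ofLex i).1)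
      (fun i : ℕ ×ₗ Fin k => q ^ ((ofLex i).1 + 1)) ∘ Subtype.val) p =
      thetaCoeff q k 0 / qPoch q q ^ k := by
    rw [← pairCoeff_colored hq0 hq, pairCoeff]
    refine (tsum_subtype {p : Finset (ℕ ×ₗ Fin k) × Finset (ℕ ×ₗ Fin k) | p.1.card = p.2.card}
      _).trans (tsum_congr fun p => ?_)
    rw [Set.indicator_apply]
    congr 1
    rw [Set.mem_ofPred_eq, sub_eq_zero, Nat.cast_inj]
  rw [e2] at h2
  exact (funext e : _ = fun p : BalancedPair k => q ^ p.size) ▸ h2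

/-- The generating function of `cφ_k` is the constant term of the `k`-th power of the theta series,
divided by `(q; q)_∞ ^ k`. -/
lemma hasSum_cphi {q : ℂ} (hq0 : q ≠ 0) (hq : ‖q‖ < 1) (k : ℕ) :
    HasSum (fun n : ℕ => (cphi k n : ℂ) * q ^ n) (thetaCoeff q k 0 / qPoch q q ^ k) := by
  have hS := hasSum_pow_size hq0 hq k
  rw [← (Equiv.sigmaFiberEquiv (BalancedPair.size (k := k))).hasSum_iff] at hS
  have h := hS.sigma fun n => (hS.summable.sigma_factor n).hasSum
  convert! h using 1
  ext n
  have e : ∀ p : {p : BalancedPair k // p.size = n},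
      ((fun p : BalancedPair k => q ^ p.size) ∘
        (Equiv.sigmaFiberEquiv (BalancedPair.size (k := k)))) ⟨n, p⟩ = q ^ n := by
    intro p
    simp only [Function.comp_apply, Equiv.sigmaFiberEquiv, Equiv.coe_fn_mk, p.2]
  rw [tsum_congr e, tsum_const, cphi,
    Nat.card_congr (Equiv.ofBijective _ (FPartition.rows_bijective k n)), nsmul_eq_mul]

/-! ### The list of terms and its computability -/

/-- The integer in `[0, k (k + 1))` congruent to `k (k + 1) / 2 + (k + 1) j - k r`. -/
def thetaResidue (k r j : ℕ) : ℕ := (k * (k + 1) / 2 + (k + 1) * j + k * k * r) % (k * (k + 1))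

/-- The smallest exponent of `q` in `q ^ tri (r - j) * quadSum q M s`, where `M = k (k + 1) / 2` and
`s = (k + 1) j - k r`. It equals `tri (r - j) + ((a - M)² - s²) / (4 M)` with `a` the residue
`thetaResidue k r j`. The positive and the negative parts of the numerator are collected separately,
so that the subtraction and the division of natural numbers are exact. -/
def thetaExponent (k r j : ℕ) : ℕ :=
  ((k * (k + 1) * (r * r + j * j + j) + thetaResidue k r j * thetaResidue k r j +
      k * (k + 1) / 2 * (k * (k + 1) / 2) + 2 * ((k + 1) * j) * (k * r)) -
    (k * (k + 1) * (2 * r * j + r) + thetaResidue k r j * (k * (k + 1)) +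
      (k + 1) * j * ((k + 1) * j) + k * r * (k * r))) / (2 * (k * (k + 1)))

/-- The product of a term with
`q ^ tri (r - j) * quadSum q (k (k + 1) / 2) ((k + 1) j - k r) / (q; q)_∞`, as a term. -/
def expandTerm (k r j : ℕ) (t : PochTerm) : PochTerm :=
  ((if thetaResidue k r j = 0 then 2 else 1) * t.1, thetaExponent k r j + t.2.1,
    (k * (k + 1), k * (k + 1)) ::
      (2 * (if thetaResidue k r j = 0 then k * (k + 1) else thetaResidue k r j),
        2 * (k * (k + 1))) ::
      (2 * (k * (k + 1) - thetaResidue k r j), 2 * (k * (k + 1))) :: t.2.2.1,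
    ((if thetaResidue k r j = 0 then k * (k + 1) else thetaResidue k r j), k * (k + 1)) ::
      (k * (k + 1) - thetaResidue k r j, k * (k + 1)) :: (1, 1) :: t.2.2.2)

/-- The list whose entries `(r, t)`, for fixed `r < n + 1`, sum up to
`thetaCoeff q (n + 1) r / (q; q)_∞ ^ (n + 1)`. -/
def expansion : ℕ → List (ℕ × PochTerm)
  | 0 => [(0, (1, 0, [], [(1, 1)]))]
  | n + 1 => (expansion n).flatMap fun p =>
      (List.range (n + 2)).map fun r => (r, expandTerm (n + 1) r p.1 p.2)

/-- The terms whose sum is the generating function of `cφ_k`. -/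
def frobeniusTerms (k : ℕ) : List PochTerm :=
  ((expansion (k - 1)).filter fun p => p.1 = 0).map Prod.snd

section Computability
open Primrec

variable {α : Type*} [Primcodable α] {k r j : α → ℕ}

lemma primrec_mul_succ (hk : Primrec k) : Primrec fun x => k x * (k x + 1) :=
  nat_mul.comp hk (Primrec.succ.comp hk)

lemma primrec_thetaResidue (hk : Primrec k) (hr : Primrec r) (hj : Primrec j) :
    Primrec fun x => thetaResidue (k x) (r x) (j x) :=
  nat_mod.comp (nat_add.comp (nat_add.comp (nat_div.comp (primrec_mul_succ hk) (const 2))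
    (nat_mul.comp (Primrec.succ.comp hk) hj)) (nat_mul.comp (nat_mul.comp hk hk) hr))
    (primrec_mul_succ hk)

lemma primrec_thetaExponent (hk : Primrec k) (hr : Primrec r) (hj : Primrec j) :
    Primrec fun x => thetaExponent (k x) (r x) (j x) := by
  have hN := primrec_mul_succ hk
  have hM := nat_div.comp hN (const 2)
  have ha := primrec_thetaResidue hk hr hj
  have hx := nat_mul.comp (Primrec.succ.comp hk) hj
  have hy := nat_mul.comp hk hr
  exact nat_div.comp (nat_sub.comp
    (nat_add.comp (nat_add.comp (nat_add.comp
      (nat_mul.comp hN (nat_add.comp (nat_add.comp (nat_mul.comp hr hr) (nat_mul.comp hj hj)) hj))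
      (nat_mul.comp ha ha)) (nat_mul.comp hM hM)) (nat_mul.comp (nat_mul.comp (const 2) hx) hy))
    (nat_add.comp (nat_add.comp (nat_add.comp
      (nat_mul.comp hN (nat_add.comp (nat_mul.comp (nat_mul.comp (const 2) hr) hj) hr))
      (nat_mul.comp ha hN)) (nat_mul.comp hx hx)) (nat_mul.comp hy hy)))
    (nat_mul.comp (const 2) hN)

lemma primrec_expandTerm {t : α → PochTerm} (hk : Primrec k) (hr : Primrec r) (hj : Primrec j)
    (ht : Primrec t) : Primrec fun x => expandTerm (k x) (r x) (j x) (t x) := by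
  have hN := primrec_mul_succ hk
  have ha := primrec_thetaResidue hk hr hj
  have hp : PrimrecPred fun x => thetaResidue (k x) (r x) (j x) = 0 :=
    Primrec.eq.comp ha (const 0)
  have ha' := Primrec.ite hp hN ha
  have hb := nat_sub.comp hN ha
  have h2N := nat_mul.comp (const 2) hN
  have ht2 := Primrec.snd.comp (Primrec.snd.comp ht)
  exact (nat_mul.comp (Primrec.ite hp (const 2) (const 1)) (Primrec.fst.comp ht)).pair
    ((nat_add.comp (primrec_thetaExponent hk hr hj) (Primrec.fst.comp (Primrec.snd.comp ht))).pair
    ((list_cons.comp (hN.pair hN) (list_cons.comp ((nat_mul.comp (const 2) ha').pair h2N)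
      (list_cons.comp ((nat_mul.comp (const 2) hb).pair h2N) (Primrec.fst.comp ht2)))).pair
    (list_cons.comp (ha'.pair hN) (list_cons.comp (hb.pair hN)
      (list_cons.comp (const (1, 1)) (Primrec.snd.comp ht2))))))

lemma primrec_expansion : Primrec expansion := by
  have hstep : Primrec₂ fun (n : ℕ) (S : List (ℕ × PochTerm)) => S.flatMap fun p =>
      (List.range (n + 2)).map fun r => (r, expandTerm (n + 1) r p.1 p.2) := by
    refine list_flatMap Primrec.snd (list_map ?_ ?_)
    · exact list_range.comp (Primrec.succ.comp (Primrec.succ.comp (Primrec.fst.comp Primrec.fst)))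
    · have hp : Primrec fun x : ((ℕ × List (ℕ × PochTerm)) × (ℕ × PochTerm)) × ℕ => x.1.2 :=
        Primrec.snd.comp Primrec.fst
      exact Primrec.snd.pair (primrec_expandTerm (Primrec.succ.comp
        (Primrec.fst.comp (Primrec.fst.comp Primrec.fst))) Primrec.snd (Primrec.fst.comp hp)
        (Primrec.snd.comp hp))
  refine (nat_rec₁ [(0, (1, 0, [], [(1, 1)]))] hstep).of_eq fun n => ?_
  induction n with
  | zero => rfl
  | succ n ih => rw [expansion, ← ih]

lemma computable_frobeniusTerms : Computable frobeniusTerms := by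
  have h : Primrec fun k => expansion (k - 1) :=
    primrec_expansion.comp (nat_sub.comp Primrec.id (const 1))
  have hp : PrimrecPred fun p : ℕ × PochTerm => p.1 = 0 :=
    Primrec.eq.comp Primrec.fst (const 0)
  have h2 : Primrec fun k => (expansion (k - 1)).filter fun p => p.1 = 0 := (listFilter hp).comp h
  have h3 : Primrec frobeniusTerms := list_map h2 (Primrec.snd.comp Primrec.snd)
  exact h3.to_comp

end Computability

/-! ### The value of the list of terms -/

lemma thetaResidue_lt {k : ℕ} (hk : 0 < k) (r j : ℕ) : thetaResidue k r j < k * (k + 1) :=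
  Nat.mod_lt _ (by positivity)

lemma expandTerm_valid {k : ℕ} (hk : 0 < k) (r j : ℕ) {t : PochTerm} (ht : t.Valid) :
    (expandTerm k r j t).Valid := by
  have hlt := thetaResidue_lt hk r j
  simp only [PochTerm.Valid, expandTerm, List.forall_mem_append, List.forall_mem_cons] at ht ⊢
  refine ⟨⟨?_, ?_, ?_, ht.1⟩, ?_, ?_, ?_, ht.2⟩ <;> constructor <;> (try split_ifs) <;> omega

/-- There is a shift `v` of the summation variable which brings `(k + 1) j - k r` into the interval
`[-k (k + 1) / 2, k (k + 1) / 2)`. The exponent of `q` that arises from it together with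
`tri (r - j)` is the natural number `thetaExponent k r j`. -/
lemma exists_shift {k : ℕ} (hk : 0 < k) (r : ℕ) {j : ℕ} (hj : j ≤ k) :
    ∃ v : ℤ, ((k + 1) * j - k * r : ℤ) + 2 * (k * (k + 1) / 2 : ℕ) * v =
        thetaResidue k r j - (k * (k + 1) / 2 : ℕ) ∧
      (thetaExponent k r j : ℤ) = tri (r - j) + ((k * (k + 1) / 2 : ℕ) * v ^ 2 +
        ((k + 1) * j - k * r) * v) := by
  set M := k * (k + 1) / 2 with hM
  have hN : k * (k + 1) = 2 * M := by
    have := Nat.div_mul_cancel (even_iff_two_dvd.mp (Nat.even_mul_succ_self k))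
    omega
  have hNz : (k : ℤ) * (k + 1) = 2 * M := by exact_mod_cast hN
  have hMpos : 0 < M := by
    have : 0 < k * (k + 1) := by positivity
    omega
  set a := thetaResidue k r j with ha
  set w := (M + (k + 1) * j + k * k * r) / (k * (k + 1)) with hw
  have haw : (a : ℤ) + k * (k + 1) * w = M + (k + 1) * j + k * k * r := by
    have := Nat.mod_add_div (M + (k + 1) * j + k * k * r) (k * (k + 1))
    rw [← hw] at this
    exact_mod_cast this
  have hv : ((k + 1) * j - k * r : ℤ) + 2 * M * (r - w) = a - M := by
    rw [← hNz]
    linear_combination -haw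
  refine ⟨r - w, hv, ?_⟩
  set v : ℤ := r - w with hvdef
  set s : ℤ := (k + 1) * j - k * r with hs
  -- This is the exponent in the summand with `u = v`, written as a sum of nonnegative terms.
  have hE : (tri (r - j) : ℤ) + (M * v ^ 2 + s * v) = tri (r - j - k * v) + k * tri v + v * j := by
    have h1 := two_mul_tri (r - j)
    have h2 := two_mul_tri (r - j - k * v)
    have h3 := two_mul_tri v
    refine mul_left_cancel₀ (two_ne_zero (α := ℤ)) ?_
    rw [hs]
    linear_combination h1 - h2 - k * h3 - v ^ 2 * hNz
  have hE0 : 0 ≤ (tri (r - j) : ℤ) + (M * v ^ 2 + s * v) := by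
    rw [hE]
    have hjz : (j : ℤ) ≤ k := by exact_mod_cast hj
    have h3 := two_mul_tri v
    have h4 : 0 ≤ (k : ℤ) * tri v + v * j := by
      rcases le_or_gt 0 v with h | h
      · positivity
      · have : -v ≤ tri v := by nlinarith
        nlinarith
    have : (0 : ℤ) ≤ tri (r - j - k * v) := by positivity
    linarith
  obtain ⟨E, hEn⟩ := Int.eq_ofNat_of_zero_le hE0
  rw [hEn, Nat.cast_inj, thetaExponent, ← ha, ← hM, hN]
  have h1 := two_mul_tri (r - j)
  have key : 2 * M * (r * r + j * j + j) + a * a + M * M + 2 * ((k + 1) * j) * (k * r) =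
      E * (2 * (2 * M)) + (2 * M * (2 * r * j + r) + a * (2 * M) + (k + 1) * j * ((k + 1) * j) +
        k * r * (k * r)) := by
    zify
    have h5 : ((a : ℤ) - M) ^ 2 = (s + 2 * M * v) ^ 2 := by rw [hv]
    rw [← hEn]
    rw [hs] at h5 ⊢
    linear_combination h5 - 2 * M * h1
  rw [key, Nat.add_sub_cancel, Nat.mul_div_cancel _ (by omega)]

/-- `(-x; Q)_∞ = (x²; Q²)_∞ / (x; Q)_∞`. For `x = 1` the denominator vanishes; there the factor
`1 + x = 2` is split off first. -/
lemma qPoch_neg_pow {q : ℂ} (hq : ‖q‖ < 1) {a N : ℕ} (hN : 0 < N) :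
    qPoch (-q ^ a) (q ^ N) = (if a = 0 then 2 else 1 : ℕ) *
      (qPoch (q ^ (2 * (if a = 0 then N else a))) (q ^ (2 * N)) /
        qPoch (q ^ (if a = 0 then N else a)) (q ^ N)) := by
  have hQ := norm_pow_lt_one hq hN
  have h : ∀ b : ℕ, 0 < b → qPoch (-q ^ b) (q ^ N) =
      qPoch (q ^ (2 * b)) (q ^ (2 * N)) / qPoch (q ^ b) (q ^ N) := by
    intro b hb
    rw [eq_div_iff (qPoch_ne_zero_of_norm_lt_one hQ (norm_pow_lt_one hq hb)),
      qPoch_neg_mul_qPoch _ hQ, ← pow_mul, ← pow_mul, mul_comm b, mul_comm N]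
  split_ifs with h0
  · rw [← h N hN, h0, qPoch_eq_mul _ hQ, pow_zero, neg_one_mul]
    push_cast
    ring
  · rw [← h a (by omega), Nat.cast_one, one_mul]

lemma eval_expandTerm {q : ℂ} (hq0 : q ≠ 0) (hq : ‖q‖ < 1) {k : ℕ} (hk : 0 < k) (r : ℕ) {j : ℕ}
    (hj : j ≤ k) (t : PochTerm) :
    (expandTerm k r j t).eval q = t.eval q * (q ^ tri (r - j) *
      quadSum q (k * (k + 1) / 2) ((k + 1) * j - k * r) / qPoch q q) := by
  obtain ⟨v, hv, he⟩ := exists_shift hk r hj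
  have hlt := thetaResidue_lt hk r j
  have hN : 0 < k * (k + 1) := by positivity
  have hM2 : 2 * (k * (k + 1) / 2) = k * (k + 1) := by
    have := Nat.div_mul_cancel (even_iff_two_dvd.mp (Nat.even_mul_succ_self k))
    omega
  have hsum : q ^ tri (r - j) * quadSum q (k * (k + 1) / 2) ((k + 1) * j - k * r) =
      q ^ thetaExponent k r j * (qPoch (q ^ (k * (k + 1))) (q ^ (k * (k + 1))) *
        (qPoch (-q ^ thetaResidue k r j) (q ^ (k * (k + 1))) *
          qPoch (-q ^ (k * (k + 1) - thetaResidue k r j)) (q ^ (k * (k + 1))))) := by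
    rw [quadSum_shift hq0 _ _ v, hv, quadSum_eq_qPoch hq0 hq (by omega), hM2, ← mul_assoc,
      ← zpow_natCast q (tri _), ← zpow_natCast q (thetaExponent k r j), ← zpow_add₀ hq0, ← he,
      add_sub_cancel, zpow_natCast q (thetaResidue k r j),
      show ((k * (k + 1) / 2 : ℕ) : ℤ) - (thetaResidue k r j - (k * (k + 1) / 2 : ℕ)) =
        ((k * (k + 1) - thetaResidue k r j : ℕ) : ℤ) by omega, zpow_natCast q (_ - _)]
  rw [hsum, qPoch_neg_pow hq hN, qPoch_neg_pow hq hN,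
    if_neg (by omega : k * (k + 1) - thetaResidue k r j ≠ 0),
    if_neg (by omega : k * (k + 1) - thetaResidue k r j ≠ 0)]
  simp only [PochTerm.eval, expandTerm, pochProd, List.map_cons, List.prod_cons, pow_one]
  push_cast
  rw [pow_add]
  ring

lemma expansion_mem (n : ℕ) : ∀ p ∈ expansion n, p.1 < n + 1 ∧ PochTerm.Valid p.2 := by
  induction n with
  | zero =>
    intro p hp
    obtain rfl : p = _ := by simpa [expansion] using hp
    refine ⟨by norm_num, fun p hp => ?_⟩
    obtain rfl : p = (1, 1) := by simpa using hp
    simp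
  | succ n ih =>
    intro p hp
    simp only [expansion, List.mem_flatMap, List.mem_map, List.mem_range] at hp
    obtain ⟨p', hp', r, hr, rfl⟩ := hp
    exact ⟨hr, expandTerm_valid (Nat.succ_pos n) r p'.1 (ih p' hp').2⟩

/-- Sorting a list sum by the first components of the entries. -/
lemma sum_map_eq_sum_range {m : ℕ} {S : List (ℕ × PochTerm)} (hS : ∀ p ∈ S, p.1 < m)
    (f : PochTerm → ℂ) (W : ℕ → ℂ) :
    (S.map fun p => f p.2 * W p.1).sum =
      ∑ j ∈ Finset.range m, (S.map fun p => if p.1 = j then f p.2 else 0).sum * W j := by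
  induction S with
  | nil => simp
  | cons p S ih =>
    simp only [List.map_cons, List.sum_cons, add_mul, Finset.sum_add_distrib]
    rw [ih fun p' hp' => hS p' (List.mem_cons_of_mem _ hp')]
    simp only [ite_mul, zero_mul, Finset.sum_ite_eq]
    rw [if_pos (Finset.mem_range.mpr (hS p List.mem_cons_self))]

lemma sum_map_range (f : ℕ → ℂ) (n : ℕ) :
    ((List.range n).map f).sum = ∑ i ∈ Finset.range n, f i := by
  induction n with
  | zero => simp
  | succ n ih => simp [List.range_succ, Finset.sum_range_succ, ih]

lemma sum_map_flatMap {α β : Type*} (S : List α) (g : α → List β) (f : β → ℂ) :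
    ((S.flatMap g).map f).sum = (S.map fun p => ((g p).map f).sum).sum := by
  induction S with
  | nil => simp
  | cons p S ih => simp [ih]

lemma sum_expansion {q : ℂ} (hq0 : q ≠ 0) (hq : ‖q‖ < 1) (n : ℕ) {r : ℕ} (hr : r < n + 1) :
    ((expansion n).map fun p => if p.1 = r then PochTerm.eval p.2 q else 0).sum =
      thetaCoeff q (n + 1) r / qPoch q q ^ (n + 1) := by
  induction n generalizing r with
  | zero =>
    obtain rfl : r = 0 := by omega
    simp [expansion, PochTerm.eval, pochProd, thetaCoeff_one, tri]
  | succ n ih =>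
    have h1 : ((expansion (n + 1)).map fun p => if p.1 = r then PochTerm.eval p.2 q else 0).sum =
        ((expansion n).map fun p => PochTerm.eval p.2 q * (q ^ tri (r - p.1) *
          quadSum q ((n + 1) * (n + 1 + 1) / 2) (((n + 1 : ℕ) + 1) * p.1 - (n + 1 : ℕ) * r) /
            qPoch q q)).sum := by
      have hp : ∀ p ∈ expansion n,
          ((List.range (n + 2)).map fun r' => if r' = r then
            PochTerm.eval (expandTerm (n + 1) r' p.1 p.2) q else 0).sum =
          PochTerm.eval p.2 q * (q ^ tri (r - p.1) *
          quadSum q ((n + 1) * (n + 1 + 1) / 2) (((n + 1 : ℕ) + 1) * p.1 - (n + 1 : ℕ) * r) /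
            qPoch q q) := by
        intro p hp
        rw [← eval_expandTerm hq0 hq (Nat.succ_pos n) r (expansion_mem n p hp).1.le,
          sum_map_range, Finset.sum_ite_eq', if_pos (Finset.mem_range.mpr hr)]
      rw [expansion, sum_map_flatMap, ← List.map_congr_left hp]
      simp only [List.map_map, Function.comp_def]
    rw [h1, sum_map_eq_sum_range (fun p hp => (expansion_mem n p hp).1) (fun t => t.eval q)
      fun j => q ^ tri (r - j) *
          quadSum q ((n + 1) * (n + 1 + 1) / 2) (((n + 1 : ℕ) + 1) * j - (n + 1 : ℕ) * r) /
            qPoch q q, thetaCoeff_succ hq0 hq (Nat.succ_pos n), Finset.sum_div]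
    refine Finset.sum_congr rfl fun j hj => ?_
    rw [ih (Finset.mem_range.mp hj), pow_succ]
    ring

lemma frobeniusTerms_valid (k : ℕ) : ∀ t ∈ frobeniusTerms k, t.Valid := by
  intro t ht
  obtain ⟨p, hp, rfl⟩ := List.mem_map.mp ht
  exact (expansion_mem _ p (List.mem_of_mem_filter hp)).2

lemma sumEval_frobeniusTerms {q : ℂ} (hq0 : q ≠ 0) (hq : ‖q‖ < 1) {k : ℕ} (hk : 0 < k) :
    sumEval (frobeniusTerms k) q = thetaCoeff q k 0 / qPoch q q ^ k := by
  have h := sum_expansion hq0 hq (k - 1) (r := 0) (by omega)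
  rw [Nat.sub_add_cancel hk] at h
  rw [sumEval, frobeniusTerms, List.map_map]
  refine Eq.trans ?_ h
  induction expansion (k - 1) with
  | nil => simp
  | cons p S ih =>
    by_cases hp : p.1 = 0 <;> simp [hp] <;> simpa using ih

/-! ### The point `q = 0` -/

section AtZero

lemma continuousAt_qPoch {i j : ℕ} (hi : 0 < i) (hj : 0 < j) :
    ContinuousAt (fun q : ℂ => qPoch (q ^ i) (q ^ j)) 0 := by
  have h : ∀ q : ℂ, qPoch (q ^ i) (q ^ j) = ∏' n : ℕ, (1 + -(q ^ i * (q ^ j) ^ n)) := fun q => by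
    simp [qPoch, sub_eq_add_neg]
  simp_rw [ContinuousAt, h]
  refine tendsto_tprod_one_add_of_dominated_convergence (bound := fun n => (1 / 2 : ℝ) ^ n)
    (summable_geometric_of_lt_one (by norm_num) (by norm_num)) (fun n => ?_) ?_
  · exact (by fun_prop : Continuous fun q : ℂ => -(q ^ i * (q ^ j) ^ n)).tendsto 0
  · filter_upwards [Metric.ball_mem_nhds (0 : ℂ) (by norm_num : (0 : ℝ) < 1 / 2)] with q hq n
    have hq' : ‖q‖ < 1 / 2 := by simpa using hq
    rw [norm_neg, norm_mul, norm_pow, norm_pow, norm_pow, ← pow_mul, ← pow_add]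
    calc ‖q‖ ^ (i + j * n) ≤ ‖q‖ ^ n :=
          pow_le_pow_of_le_one (norm_nonneg _) (by linarith) (by nlinarith)
      _ ≤ (1 / 2) ^ n := pow_le_pow_left₀ (norm_nonneg _) hq'.le n

lemma continuousAt_pochProd {l : List (ℕ × ℕ)} (hl : ∀ p ∈ l, 0 < p.1 ∧ 0 < p.2) :
    ContinuousAt (pochProd l) 0 ∧ pochProd l 0 ≠ 0 := by
  induction l with
  | nil =>
    have e : pochProd [] = fun _ => 1 := by
      ext q
      simp [pochProd]
    rw [e]
    exact ⟨continuousAt_const, one_ne_zero⟩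
  | cons p l ih =>
    have ih' := ih fun p' hp' => hl p' (List.mem_cons_of_mem _ hp')
    have hp := hl p List.mem_cons_self
    have e : ∀ q, pochProd (p :: l) q = qPoch (q ^ p.1) (q ^ p.2) * pochProd l q := fun q => by
      simp [pochProd]
    refine ⟨?_, ?_⟩
    · rw [funext e]
      exact (continuousAt_qPoch hp.1 hp.2).mul ih'.1
    · rw [e]
      refine mul_ne_zero (qPoch_ne_zero_of_norm_lt_one ?_ ?_) ih'.2 <;>
        exact norm_pow_lt_one (by simp) (by tauto)

lemma continuousAt_sumEval {s : List PochTerm} (hs : ∀ t ∈ s, t.Valid) :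
    ContinuousAt (sumEval s) 0 := by
  induction s with
  | nil =>
    have e : sumEval [] = fun _ => 0 := by
      ext q
      simp [sumEval]
    rw [e]
    exact continuousAt_const
  | cons t s ih =>
    have e : ∀ q, sumEval (t :: s) q = t.eval q + sumEval s q := fun q => by simp [sumEval]
    rw [funext e]
    refine ContinuousAt.add ?_ (ih fun t' ht' => hs t' (List.mem_cons_of_mem _ ht'))
    have ht := hs t List.mem_cons_self
    have h1 := continuousAt_pochProd fun p hp => ht p (List.mem_append_left _ hp)
    have h2 := continuousAt_pochProd fun p hp => ht p (List.mem_append_right _ hp)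
    exact ((by fun_prop : Continuous fun q : ℂ => (t.1 : ℂ) * q ^ t.2.1).continuousAt).mul
      (h1.1.div h2.1 h2.2)

/-- An identity between a power series and a function continuous at `0` extends to `0`. -/
lemma hasSum_pow_zero_of_forall_ne {c : ℕ → ℂ} {F : ℂ → ℂ} (hF : ContinuousAt F 0)
    (h : ∀ q : ℂ, q ≠ 0 → ‖q‖ < 1 → HasSum (fun n => c n * q ^ n) (F q)) :
    HasSum (fun n => c n * (0 : ℂ) ^ n) (F 0) := by
  have hs : Summable fun n => ‖c n * (1 / 2 : ℂ) ^ n‖ :=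
    (h (1 / 2) (by norm_num) (by norm_num)).summable.norm
  have hb : ∀ n, ∀ q ∈ Metric.closedBall (0 : ℂ) (1 / 2),
      ‖c n * q ^ n‖ ≤ ‖c n * (1 / 2 : ℂ) ^ n‖ := by
    intro n q hq
    have hq' : ‖q‖ ≤ 1 / 2 := by simpa using hq
    rw [norm_mul, norm_mul, norm_pow, norm_pow]
    gcongr
    simpa using hq'
  have hc : ContinuousOn (fun q => ∑' n, c n * q ^ n) (Metric.closedBall (0 : ℂ) (1 / 2)) :=
    continuousOn_tsum (fun n => by fun_prop) hs hb
  have hc0 := hc.continuousAt (Metric.closedBall_mem_nhds 0 (by norm_num))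
  have h0 : HasSum (fun n => c n * (0 : ℂ) ^ n) (∑' n, c n * (0 : ℂ) ^ n) :=
    (Summable.of_norm_bounded hs fun n => hb n 0 (by simp)).hasSum
  have heq : ∑' n, c n * (0 : ℂ) ^ n = F 0 := by
    refine tendsto_nhds_unique (hc0.tendsto.mono_left (nhdsWithin_le_nhds (s := {0}ᶜ)))
      (((hF.tendsto.mono_left nhdsWithin_le_nhds)).congr' ?_)
    filter_upwards [self_mem_nhdsWithin,
      nhdsWithin_le_nhds (Metric.ball_mem_nhds (0 : ℂ) one_pos)] with q hq hq1
    exact ((h q hq (by simpa using hq1)).tsum_eq).symm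
  rwa [heq] at h0

end AtZero

lemma hasSum_cphi_sumEval {k : ℕ} (hk : 0 < k) {q : ℂ} (hq : ‖q‖ < 1) :
    HasSum (fun n : ℕ => (cphi k n : ℂ) * q ^ n) (sumEval (frobeniusTerms k) q) := by
  have h : ∀ q : ℂ, q ≠ 0 → ‖q‖ < 1 →
      HasSum (fun n : ℕ => (cphi k n : ℂ) * q ^ n) (sumEval (frobeniusTerms k) q) := by
    intro q hq0 hq
    rw [sumEval_frobeniusTerms hq0 hq hk]
    exact hasSum_cphi hq0 hq k
  by_cases hq0 : q = 0
  · subst hq0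
    exact hasSum_pow_zero_of_forall_ne (continuousAt_sumEval (frobeniusTerms_valid k)) h
  · exact h q hq0 hq

end FrobTheta

end

theorem corollary1p2 :
    (∀ k : ℕ, 1 ≤ k →
      (∀ (τ : UpperHalfPlane) (z : ℂ),
        HasSum
          (fun n : ℤ => FrobTheta.thetaPowCoeff k n (τ : ℂ) *
            Complex.exp (2 * Real.pi * Complex.I * ((n : ℂ) + k / 2) * z))
          (FrobTheta.theta (z + 1 / 2) (τ : ℂ) ^ k)) ∧
      (∀ n : ℤ, ∃ h ∈ FrobTheta.etaKleinRing, ∀ τ : UpperHalfPlane,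
        FrobTheta.thetaPowCoeff k n (τ : ℂ) =
          FrobTheta.qPow (((n : ℝ) + k / 2) ^ 2 / (2 * k)) (τ : ℂ) * h τ)) ∧
    (∃ f : ℕ → List FrobTheta.PochTerm, Computable f ∧
      ∀ k : ℕ, 1 ≤ k →
        (∀ t ∈ f k, FrobTheta.PochTerm.Valid t) ∧
        (∀ q : ℂ, ‖q‖ < 1 →
          HasSum (fun n : ℕ => (FrobTheta.cphi k n : ℂ) * q ^ n)
            (FrobTheta.sumEval (f k) q))) := by
  refine ⟨fun k hk => ⟨fun τ z => FrobTheta.hasSum_thetaPowCoeff k τ z,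
    fun n => FrobTheta.exists_mem_thetaPowCoeff_eq hk n⟩,
    FrobTheta.frobeniusTerms, FrobTheta.computable_frobeniusTerms, fun k hk =>
      ⟨FrobTheta.frobeniusTerms_valid k, fun q hq => FrobTheta.hasSum_cphi_sumEval hk hq⟩⟩
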